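/- For a nonsingular matrix $A\in\mathbb R^{n\times n}$, Gaussian elimination with partial pivoting (GEPP) produces matrices $A=A^{(1)},A^{(2)},\dots,A^{(n)}=U$ and a factorization $PA=LU$: at step $k$, a row $i\ge k$ in which column $k$ of $A^{(k)}$ has the largest absolute value among the rows $\ge k$ (the first such row, in case of a tie) is interchanged with row $k$, and multiples of the new row $k$ are subtracted from the rows below it so that the entries of column $k$ below the diagonal become $0$. Here $P$ is a permutation matrix, $L$ is unipotent lower triangular and $U$ is upper triangular. With $\|M\|_{\max}=\max_{i,j}|M_{ij}|$, the GEPP growth factor of $A$ is $$\rho^{\mathrm{GEPP}}(A)=\frac{\|L\|_{\max}\,\max_{1\le k\le n}\|A^{(k)}\|_{\max}}{\|A\|_{\max}}.$$ Let $\mathrm O(n)$ be the group of real orthogonal $n\times n$ matrices. **Theorem.** For every $n\ge 1$ the maximum $g^{\mathrm{GEPP}}(\mathrm O(n))=\max_{Q\in \mathrm O(n)}\rho^{\mathrm{GEPP}}(Q)$ exists. For $n=1,2$, $g^{\mathrm{GEPP}}(\mathrm O(n))=2^{n-1}$. For every $n\ge 3$, $g^{\mathrm{GEPP}}(\mathrm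 O(n))<2^{n-1}$. Moreover, there is a constant $c\in[\tfrac1{\sqrt3},1)$, independent of $n$, such that for $n\ge 3$ $$g^{\mathrm{GEPP}}(\mathrm O(n))=c\,2^{n-1}(1+o(1))\qquad(n\to\infty).$$ -/

import Mathlib

open Filter Topology Asymptotics

noncomputable section

namespace GEPP

variable {n : ℕ}

/-- The max-norm `max_{i,j} |A i j|` of a real square matrix. -/
def maxNorm (A : Matrix (Fin n) (Fin n) ℝ) : ℝ := ⨆ p : Fin n × Fin n, |A p.1 p.2|

/-- The rows `i ≥ k` in which column `k` of `A` is largest in absolute value among the rows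
`≥ k`: the admissible pivot rows of partial pivoting at step `k`. -/
def pivotRows (A : Matrix (Fin n) (Fin n) ℝ) (k : Fin n) : Finset (Fin n) :=
  open Classical in
  Finset.univ.filter fun i => k ≤ i ∧ ∀ j, k ≤ j → |A j k| ≤ |A i k|

theorem pivotRows_nonempty (A : Matrix (Fin n) (Fin n) ℝ) (k : Fin n) :
    (pivotRows A k).Nonempty := by
  obtain ⟨i, hi, h⟩ := (Finset.Ici k).exists_max_image (fun i => |A i k|) ⟨k, by simp⟩
  exact ⟨i, by simpa [pivotRows] using ⟨by simpa using hi, fun j hj => h j (by simpa using hj)⟩⟩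

/-- The row chosen by partial pivoting at step `k`; ties are broken by the smallest row index. -/
def pivotRow (A : Matrix (Fin n) (Fin n) ℝ) (k : Fin n) : Fin n :=
  (pivotRows A k).min' (pivotRows_nonempty A k)

/-- Interchange the rows `k` and `p`. -/
def swapRows (k p : Fin n) (A : Matrix (Fin n) (Fin n) ℝ) : Matrix (Fin n) (Fin n) ℝ :=
  A.submatrix (Equiv.swap k p) id

/-- One elimination step without pivoting: multiples of row `k` are subtracted from the rows
below it, so as to make the entries of column `k` below the diagonal vanish. -/
def eliminate (k : Fin n) (A : Matrix (Fin n) (Fin n) ℝ) : Matrix (Fin n) (Fin n) ℝ :=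
  Matrix.of fun i j => if k < i then A i j - A i k / A k k * A k j else A i j

/-- Write the multipliers of the elimination step `k` on `A` below the diagonal in column `k`
of `M`. -/
def recordMultipliers (k : Fin n) (A M : Matrix (Fin n) (Fin n) ℝ) :
    Matrix (Fin n) (Fin n) ℝ :=
  Matrix.of fun i j => if j = k ∧ k < i then A i k / A k k else M i j

/-- The state of Gaussian elimination with partial pivoting on `A` after `k` steps (nothing
happens after `n` steps): the first component is the partially eliminated matrix, the second one
is the strictly lower triangular matrix of the multipliers used so far, whose rows are
interchanged along with those of the first component. -/
def state (A : Matrix (Fin n) (Fin n) ℝ) :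
    ℕ → Matrix (Fin n) (Fin n) ℝ × Matrix (Fin n) (Fin n) ℝ
  | 0 => (A, 0)
  | k + 1 =>
    if h : k < n then
      let S := state A k
      let p := pivotRow S.1 ⟨k, h⟩
      let B := swapRows ⟨k, h⟩ p S.1
      (eliminate ⟨k, h⟩ B, recordMultipliers ⟨k, h⟩ B (swapRows ⟨k, h⟩ p S.2))
    else state A k

/-- The matrix after `k` steps of Gaussian elimination with partial pivoting. With `A⁽¹⁾ = A` and
the usual numbering, this is `A⁽ᵏ⁺¹⁾`, and `stage A (n - 1)` is the factor `U` of `P A = L U`. -/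
def stage (A : Matrix (Fin n) (Fin n) ℝ) (k : ℕ) : Matrix (Fin n) (Fin n) ℝ := (state A k).1

/-- The unipotent lower triangular factor `L` of the factorization `P A = L U` computed by
Gaussian elimination with partial pivoting. -/
def lowerFactor (A : Matrix (Fin n) (Fin n) ℝ) : Matrix (Fin n) (Fin n) ℝ := 1 + (state A n).2

/-- The growth factor `‖L‖_max * max_{1 ≤ k ≤ n} ‖A⁽ᵏ⁾‖_max / ‖A‖_max` of `A` under Gaussian
elimination with partial pivoting. -/
def growthFactor (A : Matrix (Fin n) (Fin n) ℝ) : ℝ :=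
  maxNorm (lowerFactor A) * (⨆ k : Fin n, maxNorm (stage A k)) / maxNorm A

/-- The growth factors of the orthogonal matrices of order `n`. -/
def orthogonalGrowthFactors (n : ℕ) : Set ℝ :=
  growthFactor '' (Matrix.orthogonalGroup (Fin n) ℝ : Set (Matrix (Fin n) (Fin n) ℝ))

/-- The largest growth factor, under Gaussian elimination with partial pivoting, of an orthogonal
matrix of order `n`. -/
def maxOrthogonalGrowth (n : ℕ) : ℝ := sSup (orthogonalGrowthFactors n)

end GEPP

end

noncomputable section

namespace GEPP

variable {n : ℕ}

/-! ### The partially eliminated matrices and the multipliers -/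

/-! The constant is 2/3. Partial pivoting keeps the multipliers at most 1 in absolute value, so
after row interchanges an orthogonal matrix becomes Q = LU with L unipotent lower triangular and |L
i j| ≤ 1. Conversely, partial pivoting leaves such a product in place (`state_mul`). Let n = N + 1
and let u be the last pivot.

Upper bound. From U Qᵀ L = 1, the last column of Q times u is the last row x of L⁻¹. Back
substitution bounds its entries, read from the right, by 1, 1, 2, 4, …, 2^(N-1). Moreover ‖x‖ = |u|
and |x i| ≤ |u| ‖Q‖_max. Under these constraints `sum_sq_le_mul` gives |u| ≤ ‖Q‖_max (4^N + 2) / (3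
· 2^(N-1)), about (2/3) 2^N. All other entries that occur are at most 2^(N-1) ‖Q‖_max, which is
smaller. The bound is below 2^N as soon as N ≥ 2.

Lower bound. If every entry of L below the diagonal were -1, then x would be extremal and the last
column of Q would have largest entry about √3/2, but other columns might have larger ones. In
`pairedLower` one entry in each row of the lower half, far from the diagonal, is changed to 1. This
costs x only a factor 1 + o(1) and keeps all other entries of Q at most √3/2
(`sq_pairedLower_mul_le`).

The maximum exists by compactness of the set of pairs (L, Q), on which the growth is continuous
(`exists_isGreatest`). -/

/-- The strictly lower triangular matrix of the multipliers of the first `k` steps. -/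
def multipliers (A : Matrix (Fin n) (Fin n) ℝ) (k : ℕ) : Matrix (Fin n) (Fin n) ℝ :=
  (state A k).2

/-- The transposition performed by partial pivoting on `A` at step `k`. -/
def pivotSwap (A : Matrix (Fin n) (Fin n) ℝ) (k : Fin n) : Equiv.Perm (Fin n) :=
  Equiv.swap k (pivotRow (stage A k) k)

theorem pivotRow_mem (A : Matrix (Fin n) (Fin n) ℝ) (k : Fin n) :
    k ≤ pivotRow A k ∧ ∀ j, k ≤ j → |A j k| ≤ |A (pivotRow A k) k| := by
  have h : pivotRow A k ∈ pivotRows A k := (pivotRows A k).min'_mem (pivotRows_nonempty A k)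
  rw [pivotRows, Finset.mem_filter] at h
  exact h.2

theorem pivotSwap_of_lt (A : Matrix (Fin n) (Fin n) ℝ) {k i : Fin n} (h : i < k) :
    pivotSwap A k i = i :=
  Equiv.swap_apply_of_ne_of_ne h.ne (h.trans_le (pivotRow_mem _ k).1).ne

theorem le_pivotSwap (A : Matrix (Fin n) (Fin n) ℝ) {k i : Fin n} (h : k ≤ i) :
    k ≤ pivotSwap A k i := by
  by_contra hlt
  rw [not_le] at hlt
  have h2 := pivotSwap_of_lt A hlt
  have h3 := (pivotSwap A k).injective h2
  rw [h3] at hlt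
  exact absurd h (not_le.2 hlt)

theorem stage_succ (A : Matrix (Fin n) (Fin n) ℝ) (k i j : Fin n) :
    stage A (k + 1) i j =
      if k < i then stage A k (pivotSwap A k i) j -
          stage A k (pivotSwap A k i) k / stage A k (pivotSwap A k k) k *
            stage A k (pivotSwap A k k) j
      else stage A k (pivotSwap A k i) j := by
  simp [stage, state, k.2, eliminate, swapRows, pivotSwap]

theorem multipliers_succ (A : Matrix (Fin n) (Fin n) ℝ) (k i j : Fin n) :
    multipliers A (k + 1) i j =
      if j = k ∧ k < i then stage A k (pivotSwap A k i) k / stage A k (pivotSwap A k k) k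
      else multipliers A k (pivotSwap A k i) j := by
  simp [multipliers, stage, state, k.2, recordMultipliers, swapRows, pivotSwap]

theorem abs_stage_le_pivot (A : Matrix (Fin n) (Fin n) ℝ) {k i : Fin n} (h : k ≤ i) :
    |stage A k (pivotSwap A k i) k| ≤ |stage A k (pivotSwap A k k) k| := by
  have h2 := (pivotRow_mem (stage A k) k).2 _ (le_pivotSwap A h)
  simpa [pivotSwap] using h2

theorem multipliers_invariant (A : Matrix (Fin n) (Fin n) ℝ) (k : ℕ) (hk : k ≤ n) :
    (∀ i l : Fin n, k ≤ l ∨ i ≤ l → multipliers A k i l = 0) ∧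
      (∀ i l, |multipliers A k i l| ≤ 1) := by
  induction k with
  | zero => simp [multipliers, state]
  | succ k ih =>
    obtain ⟨h1, h2⟩ := ih (by omega)
    have hs := multipliers_succ A ⟨k, hk⟩
    simp only at hs
    refine ⟨fun i l hil => ?_, fun i l => ?_⟩
    · rw [hs, if_neg]
      · by_cases hl : k ≤ l
        · exact h1 _ _ (Or.inl hl)
        · have hi : i ≤ l := by omega
          rw [pivotSwap_of_lt A (show i < ⟨k, hk⟩ by rw [Fin.lt_def]; rw [Fin.le_def] at hi; simp; omega)]
          exact h1 _ _ (Or.inr hi)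
      · rintro ⟨rfl, h⟩
        rw [Fin.lt_def] at h
        simp [Fin.le_def] at hil h
        omega
    · rw [hs]
      split_ifs with h
      · rw [abs_div]
        exact div_le_one_of_le₀ (abs_stage_le_pivot A h.2.le) (abs_nonneg _)
      · exact h2 _ _

/-- This undoes one elimination step; accumulated over all steps it becomes PA = LU. -/
theorem stage_add_multipliers (A : Matrix (Fin n) (Fin n) ℝ) (k i j : Fin n) :
    stage A (k + 1) i j + multipliers A (k + 1) i k * stage A (k + 1) k j =
      stage A k (pivotSwap A k i) j := by
  have h0 := (multipliers_invariant A k k.2.le).1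
  rw [stage_succ A k k, stage_succ, multipliers_succ]
  by_cases h : k < i
  · simp [h]
  · simp [h, h0 (pivotSwap A k i) k]

theorem stage_lower_eq_zero (A : Matrix (Fin n) (Fin n) ℝ) (k : ℕ) (hk : k ≤ n) :
    ∀ i j : Fin n, j < k → j < i → stage A k i j = 0 := by
  induction k with
  | zero => simp
  | succ k ih =>
    intro i j hj hji
    specialize ih (by omega)
    have hs := stage_succ A ⟨k, hk⟩ i j
    simp only at hs
    have hle : ∀ i : Fin n, k ≤ i → k ≤ (pivotSwap A ⟨k, hk⟩ i : ℕ) := fun i hi =>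
      le_pivotSwap A (k := ⟨k, hk⟩) (i := i) hi
    rw [hs]
    by_cases hjk : (j : ℕ) < k
    · have h1 : stage A k (pivotSwap A ⟨k, hk⟩ ⟨k, hk⟩) j = 0 :=
        ih _ _ hjk (by have := hle ⟨k, hk⟩ le_rfl; rw [Fin.lt_def]; omega)
      have h2 : stage A k (pivotSwap A ⟨k, hk⟩ i) j = 0 := by
        by_cases hi : k ≤ i
        · exact ih _ _ hjk (by have := hle i hi; rw [Fin.lt_def]; omega)
        · rw [pivotSwap_of_lt A (k := ⟨k, hk⟩) (by rw [Fin.lt_def]; simpa using hi)]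
          exact ih _ _ hjk hji
      simp [h1, h2]
    · obtain rfl : j = ⟨k, hk⟩ := Fin.ext (by simp; omega)
      rw [if_pos hji]
      have hp := abs_stage_le_pivot A hji.le
      simp only at hp
      -- A zero pivot is still maximal in its column, so the entry to be eliminated is already zero;
      -- nonsingularity is not needed.
      by_cases h0 : stage A k (pivotSwap A ⟨k, hk⟩ ⟨k, hk⟩) ⟨k, hk⟩ = 0
      · rw [h0] at hp ⊢
        simpa using hp
      · field_simp
        ring

/-- The partially eliminated matrix and the multipliers after `k` steps determine, up to a
permutation of the rows `≥ k`, the earlier partially eliminated matrices. -/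
theorem exists_perm_stage (A : Matrix (Fin n) (Fin n) ℝ) (k m : ℕ) (hkm : k ≤ m) (hm : m ≤ n) :
    ∃ τ : Equiv.Perm (Fin n),
      (∀ i j : Fin n, (i : ℕ) < k → stage A m i j = stage A k i j) ∧
      (∀ i j, stage A m i j +
        ∑ l : Fin n, (if k ≤ l ∧ l < m then multipliers A m i l * stage A m l j else 0) =
          stage A k (τ i) j) := by
  induction m, hkm using Nat.le_induction with
  | base =>
    refine ⟨1, by simp, fun i j => ?_⟩
    rw [Finset.sum_eq_zero]
    · simp
    · intro l _
      rw [if_neg (by omega)]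
  | succ m hkm ih =>
    obtain ⟨τ, h1, h2⟩ := ih (by omega)
    set q : Fin n := ⟨m, hm⟩ with hq
    have hfix : ∀ i j : Fin n, (i : ℕ) < m → stage A (m + 1) i j = stage A m i j := by
      intro i j hi
      have := stage_succ A q i j
      simp only [hq] at this
      rw [this, if_neg (by rw [Fin.lt_def]; simp; omega),
        pivotSwap_of_lt A (by rw [Fin.lt_def]; simpa using hi)]
    refine ⟨(pivotSwap A q).trans τ, fun i j hi => ?_, fun i j => ?_⟩
    · rw [hfix i j (by omega), h1 i j hi]
    · rw [Equiv.trans_apply, ← h2]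
      have h3 := stage_add_multipliers A q i j
      simp only [hq] at h3
      rw [← h3, add_assoc]
      congr 1
      rw [← Finset.add_sum_erase _ _ (Finset.mem_univ q), if_pos ⟨hkm, by simp [hq]⟩,
        ← Finset.add_sum_erase (a := q) Finset.univ
          (fun l : Fin n => if k ≤ l ∧ l < m then _ else _) (Finset.mem_univ q),
        if_neg (by simp [hq]), zero_add]
      congr 1
      refine Finset.sum_congr rfl fun l hl => ?_
      have hlq : (l : ℕ) ≠ m := fun h => (Finset.ne_of_mem_erase hl) (Fin.ext h)
      by_cases hl2 : k ≤ l ∧ l < m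
      · rw [if_pos hl2, if_pos ⟨hl2.1, by omega⟩, hfix l j hl2.2]
        have h4 := multipliers_succ A q i l
        simp only [hq] at h4
        rw [h4, if_neg]
        intro h
        exact hlq (by simp [h.1])
      · rw [if_neg hl2, if_neg (by omega)]

/-! ### Triangular factorizations with multipliers at most one -/

/-- `L` is unipotent lower triangular with entries at most `1` in absolute value. -/
structure IsPivotedLower (L : Matrix (Fin n) (Fin n) ℝ) : Prop where
  diag : ∀ i, L i i = 1
  upper : ∀ i j, i < j → L i j = 0
  abs_le : ∀ i j, |L i j| ≤ 1

/-- `U` is upper triangular. -/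
def IsUpper (U : Matrix (Fin n) (Fin n) ℝ) : Prop := ∀ i j, j < i → U i j = 0

/-- The matrix obtained from `L * U` by `k` steps of Gaussian elimination without pivoting: the
product with `U` of the matrix obtained from `L` by replacing its first `k` columns by those of
the identity. -/
def partialProduct (k : ℕ) (L U : Matrix (Fin n) (Fin n) ℝ) : Matrix (Fin n) (Fin n) ℝ :=
  (Matrix.of fun i l : Fin n => if (l : ℕ) < k then (if i = l then 1 else 0) else L i l) * U

/-- The growth factor of the factorization `L * U`. -/
def luGrowth (L U : Matrix (Fin n) (Fin n) ℝ) : ℝ :=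
  (⨆ k : Fin n, maxNorm (partialProduct k L U)) / maxNorm (L * U)

theorem partialProduct_apply (k : ℕ) (L U : Matrix (Fin n) (Fin n) ℝ) (i j : Fin n) :
    partialProduct k L U i j =
      ∑ l : Fin n, (if (l : ℕ) < k then (if i = l then 1 else 0) else L i l) * U l j := by
  simp [partialProduct, Matrix.mul_apply]

theorem partialProduct_zero (L U : Matrix (Fin n) (Fin n) ℝ) : partialProduct 0 L U = L * U := by
  ext i j
  simp [partialProduct_apply, Matrix.mul_apply]

theorem partialProduct_succ {L : Matrix (Fin n) (Fin n) ℝ} (hL : IsPivotedLower L)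
    (U : Matrix (Fin n) (Fin n) ℝ) (k i j : Fin n) :
    partialProduct (k + 1) L U i j =
      partialProduct k L U i j - (if k < i then L i k * U k j else 0) := by
  rw [eq_sub_iff_add_eq, partialProduct_apply, partialProduct_apply,
    ← Finset.add_sum_erase _ _ (Finset.mem_univ k),
    ← Finset.add_sum_erase (a := k) Finset.univ _ (Finset.mem_univ k), add_right_comm]
  congr 1
  · rcases lt_trichotomy i k with h | rfl | h
    · simp [h.not_gt, h.ne, hL.upper i k h]
    · simp [hL.diag]
    · simp [h, h.ne']
  · refine Finset.sum_congr rfl fun l hl => ?_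
    have hlk : (l : ℕ) ≠ k := fun h => (Finset.ne_of_mem_erase hl) (Fin.ext h)
    congr 1
    by_cases h : (l : ℕ) < k
    · rw [if_pos h, if_pos (by omega)]
    · rw [if_neg h, if_neg (by omega)]

/-- Comparing pivot candidates at step k thus reduces to |L i k| ≤ 1 = L k k. -/
theorem partialProduct_col {L U : Matrix (Fin n) (Fin n) ℝ} (hU : IsUpper U)
    {k i : Fin n} (hi : k ≤ i) : partialProduct k L U i k = L i k * U k k := by
  rw [partialProduct_apply, Finset.sum_eq_single k]
  · simp
  · intro l _ hl
    rcases lt_or_gt_of_ne hl with h | h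
    · simp [h, (h.trans_le hi).ne']
    · simp [hU l k h]
  · simp

theorem partialProduct_row {L : Matrix (Fin n) (Fin n) ℝ} (hL : IsPivotedLower L)
    (U : Matrix (Fin n) (Fin n) ℝ) (m : ℕ) (k j : Fin n) (hk : k ≤ m) :
    partialProduct m L U k j = U k j := by
  rw [partialProduct_apply, Finset.sum_eq_single k]
  · by_cases h : (k : ℕ) < m <;> simp [h, hL.diag]
  · intro l _ hl
    by_cases h : (l : ℕ) < m
    · simp [h, hl.symm]
    · rw [if_neg h, hL.upper, zero_mul]
      rw [Fin.lt_def]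
      have : (l : ℕ) ≠ k := fun h => hl (Fin.ext h)
      omega
  · simp

theorem lowerFactor_isPivotedLower (A : Matrix (Fin n) (Fin n) ℝ) :
    IsPivotedLower (lowerFactor A) := by
  obtain ⟨h1, h2⟩ := multipliers_invariant A n le_rfl
  have hL : ∀ i j, lowerFactor A i j = (1 : Matrix (Fin n) (Fin n) ℝ) i j + multipliers A n i j :=
    fun i j => rfl
  refine ⟨fun i => ?_, fun i j h => ?_, fun i j => ?_⟩
  · simp [hL, h1 i i (Or.inr le_rfl)]
  · simp [hL, h1 i j (Or.inr h.le), h.ne]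
  · by_cases h : i = j
    · subst h
      simp [hL, h1 i i (Or.inr le_rfl)]
    · simpa [hL, h] using h2 i j

theorem stage_isUpper (A : Matrix (Fin n) (Fin n) ℝ) : IsUpper (stage A n) :=
  fun i j h => stage_lower_eq_zero A n le_rfl i j j.2 h

theorem exists_perm_partialProduct (A : Matrix (Fin n) (Fin n) ℝ) (k : ℕ) (hk : k ≤ n) :
    ∃ τ : Equiv.Perm (Fin n),
      partialProduct k (lowerFactor A) (stage A n) = (stage A k).submatrix τ id := by
  obtain ⟨τ, -, h⟩ := exists_perm_stage A k n hk le_rfl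
  refine ⟨τ, ?_⟩
  ext i j
  rw [Matrix.submatrix_apply, id, ← h, partialProduct_apply]
  have h1 : stage A n i j = ∑ l, (if i = l then 1 else 0) * stage A n l j := by simp
  rw [h1]
  rw [← Finset.sum_add_distrib]
  refine Finset.sum_congr rfl fun l _ => ?_
  have hL : lowerFactor A i l = (if i = l then 1 else 0) + multipliers A n i l := by
    simp [lowerFactor, multipliers, Matrix.one_apply]
  rw [hL]
  by_cases hl : (l : ℕ) < k
  · simp [hl]
  · simp [hl, not_lt.1 hl, add_mul]

theorem maxNorm_submatrix (A : Matrix (Fin n) (Fin n) ℝ) (τ : Equiv.Perm (Fin n)) :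
    maxNorm (A.submatrix τ id) = maxNorm A :=
  (τ.prodCongr (Equiv.refl (Fin n))).iSup_congr fun _ => rfl

theorem abs_le_maxNorm (A : Matrix (Fin n) (Fin n) ℝ) (i j : Fin n) : |A i j| ≤ maxNorm A :=
  le_ciSup (f := fun p : Fin n × Fin n => |A p.1 p.2|) (Set.finite_range _).bddAbove (i, j)

theorem maxNorm_le {A : Matrix (Fin n) (Fin n) ℝ} {b : ℝ} (hb : 0 ≤ b)
    (h : ∀ i j, |A i j| ≤ b) : maxNorm A ≤ b :=
  Real.iSup_le (fun p => h p.1 p.2) hb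

theorem maxNorm_nonneg (A : Matrix (Fin n) (Fin n) ℝ) : 0 ≤ maxNorm A :=
  Real.iSup_nonneg fun _ => abs_nonneg _

theorem IsPivotedLower.maxNorm_eq_one [NeZero n] {L : Matrix (Fin n) (Fin n) ℝ}
    (hL : IsPivotedLower L) : maxNorm L = 1 := by
  refine le_antisymm (maxNorm_le zero_le_one hL.abs_le) ?_
  have := abs_le_maxNorm L 0 0
  rwa [hL.diag, abs_one] at this

theorem growthFactor_eq_luGrowth [NeZero n] (A : Matrix (Fin n) (Fin n) ℝ) :
    growthFactor A = luGrowth (lowerFactor A) (stage A n) := by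
  have h : ∀ k ≤ n, maxNorm (partialProduct k (lowerFactor A) (stage A n)) =
      maxNorm (stage A k) := by
    intro k hk
    obtain ⟨τ, hτ⟩ := exists_perm_partialProduct A k hk
    rw [hτ, maxNorm_submatrix]
  rw [growthFactor, luGrowth, (lowerFactor_isPivotedLower A).maxNorm_eq_one, one_mul,
    ← partialProduct_zero, h 0 (Nat.zero_le _)]
  simp_rw [fun k : Fin n => h k k.2.le]
  rfl

theorem exists_perm_mul_eq (A : Matrix (Fin n) (Fin n) ℝ) :
    ∃ τ : Equiv.Perm (Fin n), lowerFactor A * stage A n = A.submatrix τ id := by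
  obtain ⟨τ, hτ⟩ := exists_perm_partialProduct A 0 (Nat.zero_le _)
  exact ⟨τ, by rw [← partialProduct_zero, hτ]; rfl⟩

/-- Partial pivoting performs no interchanges on a product `L * U` with multipliers at most `1`. -/
theorem state_mul {L U : Matrix (Fin n) (Fin n) ℝ} (hL : IsPivotedLower L) (hU : IsUpper U)
    (hd : ∀ i, U i i ≠ 0) (k : ℕ) (hk : k ≤ n) :
    stage (L * U) k = partialProduct k L U ∧
      ∀ i j : Fin n, (j : ℕ) < k → j < i → multipliers (L * U) k i j = L i j := by
  induction k with
  | zero => exact ⟨by rw [partialProduct_zero]; rfl, by simp⟩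
  | succ k ih =>
    obtain ⟨h1, h2⟩ := ih (by omega)
    set q : Fin n := ⟨k, hk⟩ with hq
    have hcol : ∀ i, q ≤ i → stage (L * U) k i q = L i q * U q q := fun i hi => by
      rw [h1]; exact partialProduct_col (k := q) hU hi
    have hpiv : pivotRow (stage (L * U) q) q = q := by
      refine le_antisymm ?_ (pivotRow_mem _ _).1
      -- Row q may tie with later rows; the smallest-index rule then selects q.
      refine Finset.min'_le _ _ ?_
      rw [pivotRows, Finset.mem_filter]
      refine ⟨Finset.mem_univ _, le_rfl, fun j hj => ?_⟩
      rw [hcol j hj, hcol q le_rfl, hL.diag, one_mul, abs_mul]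
      exact mul_le_of_le_one_left (abs_nonneg _) (hL.abs_le _ _)
    have hsw : pivotSwap (L * U) q = 1 := by
      rw [pivotSwap, hpiv, Equiv.swap_self]; rfl
    have hqq : stage (L * U) k q q = U q q := by rw [hcol q le_rfl, hL.diag, one_mul]
    refine ⟨?_, fun i j hj hji => ?_⟩
    · ext i j
      have hs := stage_succ (L * U) q i j
      simp only [hsw, Equiv.Perm.one_apply] at hs
      have hp := partialProduct_succ hL U q i j
      simp only [hq] at hs hp
      rw [hs, hp]
      by_cases h : q < i
      · rw [if_pos h, if_pos h, ← hq, hcol i h.le, hqq, h1,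
          partialProduct_row hL U k q j le_rfl, mul_div_cancel_right₀ _ (hd q)]
      · rw [if_neg h, if_neg h, sub_zero, h1]
    · have hs := multipliers_succ (L * U) q i j
      simp only [hsw, Equiv.Perm.one_apply] at hs
      simp only [hq] at hs
      rw [hs]
      by_cases h : j = q
      · subst h
        rw [if_pos ⟨rfl, hji⟩, hcol i hji.le, hqq, mul_div_cancel_right₀ _ (hd q)]
      · rw [if_neg (fun h' => h h'.1)]
        refine h2 i j ?_ hji
        have : (j : ℕ) ≠ k := fun h' => h (Fin.ext h')
        omega

theorem growthFactor_mul [NeZero n] {L U : Matrix (Fin n) (Fin n) ℝ} (hL : IsPivotedLower L)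
    (hU : IsUpper U) (hd : ∀ i, U i i ≠ 0) : growthFactor (L * U) = luGrowth L U := by
  rw [growthFactor, luGrowth, (lowerFactor_isPivotedLower _).maxNorm_eq_one, one_mul]
  simp_rw [fun k : Fin n => (state_mul hL hU hd k k.2.le).1]

/-! ### Growth of sequences defined by back substitution -/

/-- `z` is obtained by back substitution from `z 0 = 1` with coefficients `c` at most `1`, up to
the index `N`. -/
structure IsBackSubstitution (N : ℕ) (c : ℕ → ℕ → ℝ) (z : ℕ → ℝ) : Prop where
  zero : z 0 = 1
  coeff_le : ∀ m l, |c m l| ≤ 1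
  eq_sum : ∀ m, 1 ≤ m → m ≤ N → z m = ∑ l ∈ Finset.range m, c m l * z l

theorem IsBackSubstitution.abs_le_sum {N : ℕ} {c : ℕ → ℕ → ℝ} {z : ℕ → ℝ}
    (hz : IsBackSubstitution N c z) {m : ℕ} (h1 : 1 ≤ m) (hm : m ≤ N) :
    |z m| ≤ ∑ l ∈ Finset.range m, |z l| := by
  rw [hz.eq_sum m h1 hm]
  refine (Finset.abs_sum_le_sum_abs _ _).trans (Finset.sum_le_sum fun l _ => ?_)
  rw [abs_mul]
  exact mul_le_of_le_one_left (abs_nonneg _) (hz.coeff_le m l)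

/-- Each new term is at most the sum of the previous ones, so the partial sums at most double. -/
theorem IsBackSubstitution.sum_abs_le {N : ℕ} {c : ℕ → ℕ → ℝ} {z : ℕ → ℝ}
    (hz : IsBackSubstitution N c z) (m : ℕ) (hm : m ≤ N) :
    ∑ l ∈ Finset.range (m + 1), |z l| ≤ 2 ^ m := by
  induction m with
  | zero => simp [hz.zero]
  | succ m ih =>
    rw [Finset.sum_range_succ, pow_succ]
    have h1 := ih (by omega)
    have h2 := hz.abs_le_sum (m := m + 1) (by omega) hm
    linarith

theorem IsBackSubstitution.abs_le {N : ℕ} {c : ℕ → ℕ → ℝ} {z : ℕ → ℝ}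
    (hz : IsBackSubstitution N c z) (m : ℕ) (hm : m + 1 ≤ N) : |z (m + 1)| ≤ 2 ^ m :=
  (hz.abs_le_sum (by omega) hm).trans (hz.sum_abs_le m (by omega))

/-- The right side is 1 + (1 + 4 + … + 4^(N-1)). -/
theorem sum_sq_le {z : ℕ → ℝ} (h0 : ∀ m, 0 ≤ z m) (h1 : z 0 ≤ 1) (N : ℕ) (hN : 1 ≤ N)
    (h2 : ∀ m, m + 1 ≤ N → z (m + 1) ≤ 2 ^ m) :
    ∑ m ∈ Finset.range (N + 1), z m ^ 2 ≤ (4 ^ N + 2) / 3 := by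
  induction N, hN using Nat.le_induction with
  | base =>
    have := h2 0 le_rfl
    rw [Finset.sum_range_succ, Finset.sum_range_one]
    have := h0 0
    have := h0 1
    norm_num at *
    nlinarith
  | succ N hN ih =>
    rw [Finset.sum_range_succ]
    have h3 := ih fun m hm => h2 m (by omega)
    have h4 := pow_le_pow_left₀ (h0 _) (h2 N le_rfl) 2
    have h5 : ((2 : ℝ) ^ N) ^ 2 = 4 ^ N := by rw [← pow_mul, mul_comm, pow_mul]; norm_num
    rw [pow_succ (4 : ℝ)]
    linarith

/-- A sequence bounded by `1, 1, 2, 4, …, 2 ^ (N - 1)` and by `M` has its sum of squares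
maximized, relative to `M`, by the extremal sequence. -/
theorem sum_sq_le_mul {z : ℕ → ℝ} {M : ℝ} (h0 : ∀ m, 0 ≤ z m) (h1 : z 0 ≤ 1) (N : ℕ)
    (hN : 1 ≤ N) (h2 : ∀ m, m + 1 ≤ N → z (m + 1) ≤ 2 ^ m) (hM : ∀ m ≤ N, z m ≤ M) :
    ∑ m ∈ Finset.range (N + 1), z m ^ 2 ≤ M * ((4 ^ N + 2) / (3 * 2 ^ (N - 1))) := by
  induction N, hN using Nat.le_induction with
  | base =>
    have a := h2 0 le_rfl
    have b := hM 0 (by omega)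
    have c := hM 1 le_rfl
    have d := h0 0
    have e := h0 1
    rw [Finset.sum_range_succ, Finset.sum_range_one]
    norm_num at *
    nlinarith
  | succ N hN ih =>
    obtain ⟨N, rfl⟩ : ∃ K, N = K + 1 := ⟨N - 1, by omega⟩
    have h3 := ih (fun m hm => h2 m (by omega)) fun m hm => hM m (by omega)
    have hD := sum_sq_le h0 h1 (N + 1 + 1) (by omega) h2
    have hD' := sum_sq_le h0 h1 (N + 1) (by omega) fun m hm => h2 m (by omega)
    have hx := hM (N + 1 + 1) le_rfl
    have hx0 := h0 (N + 1 + 1)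
    have hxx : z (N + 1 + 1) ^ 2 ≤ M ^ 2 := pow_le_pow_left₀ hx0 hx 2
    have hM0 : 0 ≤ M := hx0.trans hx
    rw [Finset.sum_range_succ] at hD ⊢
    simp only [Nat.add_sub_cancel] at h3 ⊢
    have h4 : (4 : ℝ) ^ N = 2 ^ N * 2 ^ N := by rw [← mul_pow]; norm_num
    have hp : (1 : ℝ) ≤ 2 ^ N := one_le_pow₀ (by norm_num)
    rw [← mul_div_assoc, le_div_iff₀ (by positivity)] at h3 ⊢
    simp only [pow_succ, h4] at h3 hD hD' hxx ⊢
    generalize (2 : ℝ) ^ N = P at *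
    generalize ∑ m ∈ Finset.range (N + 1 + 1), z m * z m = S at *
    generalize z (N + 1 + 1) = w at *
    have hP2 : 1 ≤ P * P := by nlinarith
    -- With P and 2P the bounds on the last two terms: for M ≥ 2P the bound without M suffices. For
    -- P ≤ M ≤ 2P the last square is at most M², and the slack is a multiple of (2P - M)(6PM - 4P² -
    -- 2). For M ≤ P the last square is at most MP and the induction hypothesis covers the rest.
    rcases le_total (P * 2) M with hc | hc
    · calc _ ≤ ((P * P * 4 * 4 + 2) / 3) * (3 * (P * 2)) :=
            mul_le_mul_of_nonneg_right (by linarith) (by positivity)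
        _ = (P * 2) * (P * P * 4 * 4 + 2) := by ring
        _ ≤ _ := mul_le_mul_of_nonneg_right hc (by positivity)
    · rcases le_total P M with hc2 | hc2
      · have hd : 0 ≤ (P * 2 - M) * (6 * (P * M) - 4 * (P * P) - 2) :=
          mul_nonneg (by linarith) (by nlinarith)
        calc _ ≤ (M * M + (P * P * 4 + 2) / 3) * (3 * (P * 2)) :=
            mul_le_mul_of_nonneg_right (by linarith) (by positivity)
          _ ≤ _ := by linarith
      · have e1 : w * w ≤ M * P := mul_le_mul hx (hx.trans hc2) hx0 hM0
        have e2 := mul_le_mul_of_nonneg_right e1 (zero_le_one.trans hp)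
        have e3 := mul_le_mul_of_nonneg_left hP2 hM0
        nlinarith

/-! ### The last row of the inverse of the lower factor -/

/-- Indices are counted from the end: column N - m of x L = e_N expresses the m-th unknown through
the preceding ones, because L has unit diagonal. -/
theorem isBackSubstitution_of_mul_eq {N : ℕ} {L : Matrix (Fin (N + 1)) (Fin (N + 1)) ℝ}
    (hL : IsPivotedLower L) {x : Fin (N + 1) → ℝ}
    (hx : ∀ j, ∑ i, x i * L i j = if j = Fin.last N then 1 else 0) :
    IsBackSubstitution N (fun m l => -L ⟨N - l, by omega⟩ ⟨N - m, by omega⟩)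
      (fun m => x ⟨N - m, by omega⟩) := by
  have key : ∀ m ≤ N, x ⟨N - m, by omega⟩ +
      ∑ l ∈ Finset.range m, x ⟨N - l, by omega⟩ * L ⟨N - l, by omega⟩ ⟨N - m, by omega⟩ =
        if m = 0 then 1 else 0 := by
    intro m hm
    have h := hx ⟨N - m, by omega⟩
    rw [← Equiv.sum_comp Fin.revPerm] at h
    have h2 : ∀ i : Fin (N + 1), Fin.revPerm i = ⟨N - i, by omega⟩ := fun i => by
      ext; simp [Fin.val_rev]
    simp only [h2] at h
    rw [Fin.sum_univ_eq_sum_range (fun l : ℕ =>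
      x ⟨N - l, by omega⟩ * L ⟨N - l, by omega⟩ ⟨N - m, by omega⟩)] at h
    rw [← Finset.sum_subset (s₁ := Finset.range (m + 1))
      (Finset.range_subset_range.2 (by omega))] at h
    · rw [Finset.sum_range_succ, hL.diag, mul_one, add_comm] at h
      rw [h]
      congr 1
      simp only [Fin.ext_iff, Fin.val_last, eq_iff_iff]
      omega
    · intro l hl hl2
      simp only [Finset.mem_range] at hl hl2
      rw [hL.upper, mul_zero]
      rw [Fin.lt_def]
      simp only
      omega
  refine ⟨by simpa using key 0 (Nat.zero_le _), fun m l => ?_, fun m h1 hm => ?_⟩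
  · rw [abs_neg]; exact hL.abs_le _ _
  · have h := key m hm
    rw [if_neg (by omega)] at h
    rw [eq_neg_of_add_eq_zero_left h, ← Finset.sum_neg_distrib]
    exact Finset.sum_congr rfl fun l _ => by ring

/-- If `L * U` is orthogonal, the last column of `L * U`, scaled by the last pivot, is the last
row of the inverse of `L`. -/
theorem sum_lastCol_mul {N : ℕ} {L U : Matrix (Fin (N + 1)) (Fin (N + 1)) ℝ} (hU : IsUpper U)
    (hQ : L * U ∈ Matrix.orthogonalGroup (Fin (N + 1)) ℝ) (j : Fin (N + 1)) :
    ∑ i, U (Fin.last N) (Fin.last N) * (L * U) i (Fin.last N) * L i j =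
      if j = Fin.last N then 1 else 0 := by
  rw [Matrix.mem_orthogonalGroup_iff'] at hQ
  have h1 : U * ((L * U).transpose * L) = 1 := by
    rw [mul_eq_one_comm, Matrix.mul_assoc]; exact hQ
  have h2 := congrFun (congrFun h1 (Fin.last N)) j
  rw [Matrix.mul_apply, Finset.sum_eq_single (Fin.last N)] at h2
  · rw [Matrix.mul_apply, Finset.mul_sum] at h2
    simp only [Matrix.one_apply, Matrix.transpose_apply] at h2
    simp only [mul_assoc, eq_comm (a := j)]
    exact h2
  · intro l _ hl
    rw [hU _ _ (Fin.lt_last_iff_ne_last.2 hl), zero_mul]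
  · simp

theorem sum_lastCol_sq {N : ℕ} {Q : Matrix (Fin (N + 1)) (Fin (N + 1)) ℝ}
    (hQ : Q ∈ Matrix.orthogonalGroup (Fin (N + 1)) ℝ) (u : ℝ) (k : Fin (N + 1)) :
    ∑ i, (u * Q i k) ^ 2 = u ^ 2 := by
  rw [Matrix.mem_orthogonalGroup_iff'] at hQ
  have h := congrFun (congrFun hQ k) k
  rw [Matrix.mul_apply] at h
  simp only [Matrix.transpose_apply, Matrix.one_apply_eq] at h
  calc _ = u ^ 2 * ∑ i, Q i k * Q i k := by
        rw [Finset.mul_sum]; exact Finset.sum_congr rfl fun i _ => by ring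
    _ = u ^ 2 := by rw [h, mul_one]

/-! ### Upper bound for the growth factor -/

theorem abs_pivot_le {N : ℕ} (hN : 1 ≤ N) {L U : Matrix (Fin (N + 1)) (Fin (N + 1)) ℝ}
    (hL : IsPivotedLower L) (hU : IsUpper U)
    (hQ : L * U ∈ Matrix.orthogonalGroup (Fin (N + 1)) ℝ) :
    |U (Fin.last N) (Fin.last N)| ≤ (4 ^ N + 2) / (3 * 2 ^ (N - 1)) * maxNorm (L * U) := by
  set u := U (Fin.last N) (Fin.last N) with hu
  have hz := isBackSubstitution_of_mul_eq hL (sum_lastCol_mul hU hQ)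
  have h := sum_sq_le_mul (z := fun m => |u * (L * U) ⟨N - m, by omega⟩ (Fin.last N)|)
    (M := |u| * maxNorm (L * U)) (fun _ => abs_nonneg _) (by rw [hz.zero, abs_one]) N hN
    (fun m hm => hz.abs_le m hm) fun m _ => by
      rw [abs_mul]
      exact mul_le_mul_of_nonneg_left (abs_le_maxNorm _ _ _) (abs_nonneg _)
  have h2 := sum_lastCol_sq hQ u (Fin.last N)
  rw [← Equiv.sum_comp Fin.revPerm] at h2
  have h3 : ∀ i : Fin (N + 1), Fin.revPerm i = ⟨N - i, by omega⟩ := fun i => by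
    ext; simp [Fin.val_rev]
  simp only [h3] at h2
  rw [Fin.sum_univ_eq_sum_range
    (fun l : ℕ => (u * (L * U) ⟨N - l, by omega⟩ (Fin.last N)) ^ 2)] at h2
  simp only [sq_abs] at h
  rw [h2, ← sq_abs, sq] at h
  rcases (abs_nonneg u).eq_or_lt with h0 | h0
  · rw [← h0]
    have := maxNorm_nonneg (L * U)
    positivity
  · refine le_of_mul_le_mul_left ?_ h0
    linarith

/-- An elimination step subtracts at most one pivot row from each row, so the largest entry at most
doubles. -/
theorem abs_partialProduct_le {L : Matrix (Fin n) (Fin n) ℝ} (hL : IsPivotedLower L)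
    (U : Matrix (Fin n) (Fin n) ℝ) (k : ℕ) (hk : k ≤ n) (i j : Fin n) :
    |partialProduct k L U i j| ≤ 2 ^ k * maxNorm (L * U) := by
  induction k generalizing i with
  | zero => rw [partialProduct_zero, pow_zero, one_mul]; exact abs_le_maxNorm _ _ _
  | succ k ih =>
    have h := partialProduct_succ hL U ⟨k, hk⟩ i j
    simp only at h
    rw [h]
    have h1 := ih (by omega) i
    split_ifs
    · refine (abs_sub _ _).trans ?_
      have h2 := ih (by omega) ⟨k, hk⟩
      rw [partialProduct_row hL U k ⟨k, hk⟩ j le_rfl] at h2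
      rw [abs_mul]
      have h3 := mul_le_of_le_one_left (abs_nonneg (U ⟨k, hk⟩ j)) (hL.abs_le i ⟨k, hk⟩)
      rw [pow_succ]
      linarith
    · rw [sub_zero]
      refine h1.trans (mul_le_mul_of_nonneg_right ?_ (maxNorm_nonneg _))
      exact pow_le_pow_right₀ (by norm_num) (by omega)

theorem two_pow_le_bound {N : ℕ} (hN : 1 ≤ N) :
    (2 : ℝ) ^ (N - 1) ≤ (4 ^ N + 2) / (3 * 2 ^ (N - 1)) := by
  obtain ⟨N, rfl⟩ : ∃ K, N = K + 1 := ⟨N - 1, by omega⟩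
  rw [le_div_iff₀ (by positivity)]
  have h4 : (4 : ℝ) ^ N = 2 ^ N * 2 ^ N := by rw [← mul_pow]; norm_num
  simp only [pow_succ, h4, Nat.add_sub_cancel]
  nlinarith [sq_nonneg ((2 : ℝ) ^ N)]

theorem maxNorm_pos {Q : Matrix (Fin n) (Fin n) ℝ} [NeZero n]
    (hQ : Q ∈ Matrix.orthogonalGroup (Fin n) ℝ) : 0 < maxNorm Q := by
  refine (maxNorm_nonneg Q).lt_of_ne' fun h => ?_
  have h0 : Q = 0 := by
    ext i j
    have := abs_le_maxNorm Q i j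
    rw [h] at this
    simpa using this
  rw [Matrix.mem_orthogonalGroup_iff, h0] at hQ
  have := congrFun (congrFun hQ 0) 0
  simp at this

theorem luGrowth_le {N : ℕ} (hN : 1 ≤ N) {L U : Matrix (Fin (N + 1)) (Fin (N + 1)) ℝ}
    (hL : IsPivotedLower L) (hU : IsUpper U)
    (hQ : L * U ∈ Matrix.orthogonalGroup (Fin (N + 1)) ℝ) :
    luGrowth L U ≤ (4 ^ N + 2) / (3 * 2 ^ (N - 1)) := by
  rw [luGrowth, div_le_iff₀ (maxNorm_pos hQ)]
  have hm := maxNorm_nonneg (L * U)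
  have hsmall : ∀ k : ℕ, k ≤ N - 1 → ∀ i j, |partialProduct k L U i j| ≤
      (4 ^ N + 2) / (3 * 2 ^ (N - 1)) * maxNorm (L * U) := fun k hk i j =>
    (abs_partialProduct_le hL U k (by omega) i j).trans <| mul_le_mul_of_nonneg_right
      ((pow_le_pow_right₀ (by norm_num) hk).trans (two_pow_le_bound hN)) hm
  refine ciSup_le fun k => maxNorm_le (by positivity) fun i j => ?_
  by_cases hk : (k : ℕ) ≤ N - 1
  · exact hsmall k hk i j
  · have hkN : (k : ℕ) = N := by omega
    rw [hkN]
    by_cases hi : i = Fin.last N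
    · subst hi
      rw [partialProduct_row hL U N _ j (by simp)]
      by_cases hj : j = Fin.last N
      · subst hj
        exact abs_pivot_le hN hL hU hQ
      · rw [hU _ _ (Fin.lt_last_iff_ne_last.2 hj), abs_zero]
        positivity
    · have hi2 : (i : ℕ) ≠ N := fun h => hi (Fin.ext h)
      -- Rows above the last are already final at stage N - 1, so only N - 1 doublings count; the
      -- last row contains just the last pivot.
      rw [partialProduct_row hL U N i j (by omega), ← partialProduct_row hL U (N - 1) i j (by omega)]
      exact hsmall _ le_rfl i j

theorem submatrix_mem_orthogonalGroup {Q : Matrix (Fin n) (Fin n) ℝ}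
    (hQ : Q ∈ Matrix.orthogonalGroup (Fin n) ℝ) (τ : Equiv.Perm (Fin n)) :
    Q.submatrix τ id ∈ Matrix.orthogonalGroup (Fin n) ℝ := by
  rw [Matrix.mem_orthogonalGroup_iff] at hQ ⊢
  rw [Matrix.transpose_submatrix]
  have h := Matrix.submatrix_mul_equiv Q Q.transpose τ (Equiv.refl _) τ
  rw [hQ, Matrix.submatrix_one_equiv] at h
  exact h

theorem lower_mul_stage_mem (A : Matrix (Fin n) (Fin n) ℝ)
    (hA : A ∈ Matrix.orthogonalGroup (Fin n) ℝ) :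
    lowerFactor A * stage A n ∈ Matrix.orthogonalGroup (Fin n) ℝ := by
  obtain ⟨τ, hτ⟩ := exists_perm_mul_eq A
  rw [hτ]
  exact submatrix_mem_orthogonalGroup hA τ

theorem growthFactor_le {N : ℕ} (hN : 1 ≤ N) {A : Matrix (Fin (N + 1)) (Fin (N + 1)) ℝ}
    (hA : A ∈ Matrix.orthogonalGroup (Fin (N + 1)) ℝ) :
    growthFactor A ≤ (4 ^ N + 2) / (3 * 2 ^ (N - 1)) := by
  rw [growthFactor_eq_luGrowth]
  exact luGrowth_le hN (lowerFactor_isPivotedLower A) (stage_isUpper A) (lower_mul_stage_mem A hA)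

/-! ### The maximum is attained -/

theorem IsUpper.diag_ne_zero {L U : Matrix (Fin n) (Fin n) ℝ} (hU : IsUpper U)
    (hQ : L * U ∈ Matrix.orthogonalGroup (Fin n) ℝ) (i : Fin n) : U i i ≠ 0 := by
  rw [Matrix.mem_orthogonalGroup_iff'] at hQ
  have h : U.det ≠ 0 := by
    intro h
    have := congrArg Matrix.det hQ
    simp [Matrix.det_mul, h] at this
  rw [Matrix.det_of_isUpperTriangular (fun i j h => hU i j h)] at h
  exact Finset.prod_ne_zero_iff.1 h i (Finset.mem_univ i)

theorem IsPivotedLower.det_eq_one {L : Matrix (Fin n) (Fin n) ℝ} (hL : IsPivotedLower L) :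
    L.det = 1 := by
  rw [Matrix.det_of_isLowerTriangular L (fun i j h => hL.upper i j h)]
  simp [hL.diag]

theorem IsPivotedLower.mul_adjugate_mul {L : Matrix (Fin n) (Fin n) ℝ} (hL : IsPivotedLower L)
    (Q : Matrix (Fin n) (Fin n) ℝ) : L * (L.adjugate * Q) = Q := by
  rw [← Matrix.mul_assoc, Matrix.mul_adjugate, hL.det_eq_one, one_smul, Matrix.one_mul]

theorem IsPivotedLower.adjugate_mul_mul {L : Matrix (Fin n) (Fin n) ℝ} (hL : IsPivotedLower L)
    (U : Matrix (Fin n) (Fin n) ℝ) : L.adjugate * (L * U) = U := by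
  rw [← Matrix.mul_assoc, Matrix.adjugate_mul, hL.det_eq_one, one_smul, Matrix.one_mul]

theorem continuous_maxNorm [NeZero n] :
    Continuous (maxNorm : Matrix (Fin n) (Fin n) ℝ → ℝ) := by
  have h : (maxNorm : Matrix (Fin n) (Fin n) ℝ → ℝ) = fun A =>
      Finset.univ.sup' Finset.univ_nonempty fun p : Fin n × Fin n => |A p.1 p.2| := by
    funext A
    rw [Finset.sup'_univ_eq_ciSup]
    rfl
  rw [h]
  refine Continuous.finset_sup'_apply _ fun p _ => ?_
  exact (continuous_id.matrix_elem p.1 p.2).abs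

theorem continuous_partialProduct (k : ℕ) :
    Continuous fun p : Matrix (Fin n) (Fin n) ℝ × Matrix (Fin n) (Fin n) ℝ =>
      partialProduct k p.1 p.2 := by
  refine continuous_matrix fun i j => ?_
  simp only [partialProduct_apply]
  refine continuous_finsetSum _ fun l _ => ?_
  refine Continuous.mul ?_ (continuous_snd.matrix_elem l j)
  split_ifs
  · exact continuous_const
  · exact continuous_const
  · exact continuous_fst.matrix_elem i l

/-- The pairs of a lower factor and an orthogonal matrix that has a triangular factorization with
this lower factor. -/
def lowerOrthogonalPairs (n : ℕ) : Set (Matrix (Fin n) (Fin n) ℝ × Matrix (Fin n) (Fin n) ℝ) :=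
  {p | IsPivotedLower p.1 ∧ p.2 ∈ Matrix.orthogonalGroup (Fin n) ℝ ∧
    IsUpper (p.1.adjugate * p.2)}

/-- Since det L = 1, the adjugate is L⁻¹ and is polynomial in L; hence all the conditions are
closed. -/
theorem isCompact_lowerOrthogonalPairs (n : ℕ) : IsCompact (lowerOrthogonalPairs n) := by
  have hB : IsCompact {A : Matrix (Fin n) (Fin n) ℝ | ∀ i j, A i j ∈ Set.Icc (-1 : ℝ) 1} := by
    have h := isCompact_univ_pi (s := fun _ : Fin n =>
      Set.pi Set.univ fun _ : Fin n => Set.Icc (-1 : ℝ) 1)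
      fun _ => isCompact_univ_pi fun _ => isCompact_Icc
    have he : {A : Matrix (Fin n) (Fin n) ℝ | ∀ i j, A i j ∈ Set.Icc (-1 : ℝ) 1} =
        Set.pi Set.univ fun _ : Fin n => Set.pi Set.univ fun _ : Fin n => Set.Icc (-1 : ℝ) 1 :=
      Set.ext fun A => ⟨fun h i _ j _ => h i j, fun h i j => h i trivial j trivial⟩
    rw [he]
    exact h
  refine (hB.prod hB).of_isClosed_subset ?_ ?_
  · have h1 : ∀ i j, Continuous fun p : Matrix (Fin n) (Fin n) ℝ × Matrix (Fin n) (Fin n) ℝ =>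
        p.1 i j := fun i j => continuous_fst.matrix_elem i j
    have h2 : Continuous fun p : Matrix (Fin n) (Fin n) ℝ × Matrix (Fin n) (Fin n) ℝ =>
        p.1.adjugate * p.2 := continuous_fst.matrix_adjugate.matrix_mul continuous_snd
    have hset : lowerOrthogonalPairs n =
        ({p | ∀ i, p.1 i i = 1} ∩ {p | ∀ i j, i < j → p.1 i j = 0} ∩ {p | ∀ i j, |p.1 i j| ≤ 1}) ∩
          ({p | p.2 * p.2.transpose = 1} ∩
            {p | ∀ i j, j < i → (p.1.adjugate * p.2) i j = 0}) := by
      ext p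
      constructor
      · rintro ⟨⟨a, b, c⟩, d, e⟩
        exact ⟨⟨⟨a, b⟩, c⟩, (Matrix.mem_orthogonalGroup_iff _ _).1 d, e⟩
      · rintro ⟨⟨⟨a, b⟩, c⟩, d, e⟩
        exact ⟨⟨a, b, c⟩, (Matrix.mem_orthogonalGroup_iff _ _).2 d, e⟩
    rw [hset]
    simp only [Set.ofPred_forall]
    refine ((IsClosed.inter ?_ ?_).inter ?_).inter (IsClosed.inter ?_ ?_)
    · exact isClosed_iInter fun i => isClosed_eq (h1 i i) continuous_const
    · exact isClosed_iInter fun i => isClosed_iInter fun j => isClosed_iInter fun _ =>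
        isClosed_eq (h1 i j) continuous_const
    · exact isClosed_iInter fun i => isClosed_iInter fun j =>
        isClosed_le (h1 i j).abs continuous_const
    · exact isClosed_eq (continuous_snd.matrix_mul continuous_snd.matrix_transpose)
        continuous_const
    · exact isClosed_iInter fun i => isClosed_iInter fun j => isClosed_iInter fun _ =>
        isClosed_eq (h2.matrix_elem i j) continuous_const
  · rintro ⟨L, Q⟩ ⟨hL, hQ, -⟩
    refine ⟨fun i j => abs_le.1 (hL.abs_le i j), fun i j => abs_le.1 ?_⟩
    exact entry_norm_bound_of_unitary hQ i j

/-- The pivot choice is discontinuous in the matrix, so the growth is maximized over pairs (L, Q),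
where it is continuous. Elimination sends every orthogonal matrix to such a pair with the same
growth, and the product of a maximizing pair realizes its own growth because no interchanges occur.
-/
theorem exists_isGreatest (n : ℕ) [NeZero n] :
    ∃ g, IsGreatest (orthogonalGrowthFactors n) g := by
  have hne : (lowerOrthogonalPairs n).Nonempty := by
    refine ⟨(1, 1), ⟨by simp, fun i j h => by simp [h.ne], fun i j => ?_⟩, one_mem _, ?_⟩
    · change |(1 : Matrix (Fin n) (Fin n) ℝ) i j| ≤ 1
      rw [Matrix.one_apply]
      split_ifs <;> simp
    · intro i j h
      simp [h.ne']
  let φ : Matrix (Fin n) (Fin n) ℝ × Matrix (Fin n) (Fin n) ℝ → ℝ := fun p =>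
    (Finset.univ.sup' Finset.univ_nonempty fun k : Fin n =>
      maxNorm (partialProduct k p.1 (p.1.adjugate * p.2))) / maxNorm p.2
  have hφ : ContinuousOn φ (lowerOrthogonalPairs n) := by
    refine ContinuousOn.div (Continuous.continuousOn ?_)
      (continuous_maxNorm.comp continuous_snd).continuousOn fun p hp => (maxNorm_pos hp.2.1).ne'
    refine Continuous.finset_sup'_apply _ fun k _ => continuous_maxNorm.comp ?_
    exact (continuous_partialProduct (k : ℕ)).comp (continuous_fst.prodMk
      (continuous_fst.matrix_adjugate.matrix_mul continuous_snd))
  have hval : ∀ L U : Matrix (Fin n) (Fin n) ℝ, IsPivotedLower L →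
      φ (L, L * U) = luGrowth L U := by
    intro L U hL
    simp only [φ, luGrowth, hL.adjugate_mul_mul, Finset.sup'_univ_eq_ciSup]
  obtain ⟨⟨L, Q⟩, ⟨hL, hQ, hU⟩, hmax⟩ :=
    (isCompact_lowerOrthogonalPairs n).exists_isMaxOn hne hφ
  refine ⟨φ (L, Q), ⟨Q, hQ, ?_⟩, ?_⟩
  · have h := hL.mul_adjugate_mul Q
    have hd := IsUpper.diag_ne_zero (L := L) hU (by rw [h]; exact hQ)
    have h2 := growthFactor_mul hL hU hd
    rw [← hval L _ hL, h] at h2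
    exact h2
  · rintro _ ⟨A, hA, rfl⟩
    rw [growthFactor_eq_luGrowth, ← hval _ _ (lowerFactor_isPivotedLower A)]
    refine hmax ⟨lowerFactor_isPivotedLower A, lower_mul_stage_mem A hA, ?_⟩
    simp only [(lowerFactor_isPivotedLower A).adjugate_mul_mul]
    exact stage_isUpper A

/-! ### Orthogonal matrices with a prescribed lower factor -/

/-- A unipotent lower triangular matrix is the lower factor of an orthogonal matrix, whose columns
are obtained by orthonormalizing those of the given matrix. -/
theorem IsPivotedLower.exists_orthogonal {L : Matrix (Fin n) (Fin n) ℝ} (hL : IsPivotedLower L) :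
    ∃ U, IsUpper U ∧ L * U ∈ Matrix.orthogonalGroup (Fin n) ℝ ∧
      ∀ r k, r < k → ∑ i, L i r * (L * U) i k = 0 := by
  let f : Fin n → EuclideanSpace ℝ (Fin n) := fun j => WithLp.toLp 2 fun i => L i j
  let e := EuclideanSpace.basisFun (Fin n) ℝ
  let b := InnerProductSpace.gramSchmidtOrthonormalBasis (𝕜 := ℝ) (ι := Fin n)
    (E := EuclideanSpace ℝ (Fin n)) (by simp) f
  set Q := e.toBasis.toMatrix b with hQdef
  set R := b.toBasis.toMatrix f with hRdef
  have hQ : Q ∈ Matrix.orthogonalGroup (Fin n) ℝ :=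
    e.toMatrix_orthonormalBasis_mem_orthogonal b
  have hR : R.BlockTriangular id :=
    InnerProductSpace.gramSchmidtOrthonormalBasis_inv_isUpperTriangular _ f
  have hQR : Q * R = L := by
    have h := Module.Basis.toMatrix_mul_toMatrix e.toBasis b.toBasis f
    rw [OrthonormalBasis.coe_toBasis] at h
    rw [hQdef, hRdef, h]
    ext i j
    simp [Module.Basis.toMatrix_apply, e, f]
  have hdet : IsUnit R.det := by
    have h := congrArg Matrix.det hQR
    rw [Matrix.det_mul, hL.det_eq_one] at h
    exact IsUnit.of_mul_eq_one_right _ h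
  have hLU : L * R⁻¹ = Q := by
    rw [← hQR, Matrix.mul_assoc, Matrix.mul_nonsing_inv _ hdet, Matrix.mul_one]
  refine ⟨R⁻¹, ?_, by rw [hLU]; exact hQ, fun r k hrk => ?_⟩
  · have := Matrix.invertibleOfIsUnitDet R hdet
    exact fun i j h => Matrix.blockTriangular_inv_of_blockTriangular hR h
  · have h1 : Q.transpose * L = R := by
      rw [← hQR, ← Matrix.mul_assoc, (Matrix.mem_orthogonalGroup_iff' _ _).1 hQ, Matrix.one_mul]
    have h2 := congrFun (congrFun h1 k) r
    rw [hR hrk, Matrix.mul_apply] at h2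
    rw [hLU, ← h2]
    exact Finset.sum_congr rfl fun i _ => mul_comm _ _

/-- A vector orthogonal to a column of an orthogonal matrix and with a large entry in a row bounds
the entry of the matrix in this row and column. -/
theorem sq_le_one_sub_sq_mul {Q : Matrix (Fin n) (Fin n) ℝ}
    (hQ : Q ∈ Matrix.orthogonalGroup (Fin n) ℝ) {y : Fin n → ℝ} {k : Fin n}
    (hy : ∑ m, y m * Q m k = 0) (i : Fin n) :
    y i ^ 2 ≤ (1 - Q i k ^ 2) * ∑ m, y m ^ 2 := by
  have hcol : ∑ m, Q m k ^ 2 = 1 := by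
    rw [Matrix.mem_orthogonalGroup_iff'] at hQ
    have h := congrFun (congrFun hQ k) k
    rw [Matrix.mul_apply, Matrix.one_apply_eq] at h
    rw [← h]
    exact Finset.sum_congr rfl fun m _ => sq _
  -- Cauchy–Schwarz for y and the projection of e_i orthogonal to column k, whose squared length is
  -- 1 - Q i k ^ 2.
  have h := Finset.sum_mul_sq_le_sq_mul_sq Finset.univ
    (fun m => (if m = i then 1 else 0) - Q i k * Q m k) y
  have h1 : ∑ m, ((if m = i then 1 else 0) - Q i k * Q m k) * y m = y i := by
    have : ∀ m, ((if m = i then 1 else 0) - Q i k * Q m k) * y m =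
        (if m = i then y m else 0) - Q i k * (y m * Q m k) := fun m => by split_ifs <;> ring
    simp only [this, Finset.sum_sub_distrib, ← Finset.mul_sum, hy]
    simp
  have h2 : ∑ m, ((if m = i then 1 else 0) - Q i k * Q m k) ^ 2 = 1 - Q i k ^ 2 := by
    have : ∀ m, ((if m = i then 1 else 0) - Q i k * Q m k) ^ 2 =
        (if m = i then 1 - 2 * (Q i k * Q m k) else 0) + Q i k ^ 2 * Q m k ^ 2 :=
      fun m => by split_ifs <;> ring
    simp only [this, Finset.sum_add_distrib, ← Finset.mul_sum, hcol]
    simp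
    ring
  rwa [h1, h2] at h

/-- The threshold 3/4 is the limit of (2^(N-1))² / (4^N / 3), the square of the largest entry of the
extremal last column. -/
theorem sq_entry_le {Q : Matrix (Fin n) (Fin n) ℝ}
    (hQ : Q ∈ Matrix.orthogonalGroup (Fin n) ℝ) {y : Fin n → ℝ} {k : Fin n}
    (hy : ∑ m, y m * Q m k = 0) {i : Fin n} (hi : 0 < y i ^ 2)
    (h : ∑ m, y m ^ 2 ≤ 4 * y i ^ 2) : Q i k ^ 2 ≤ 3 / 4 := by
  have h1 := sq_le_one_sub_sq_mul hQ hy i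
  by_contra! hc
  have h2 : 0 ≤ ∑ m, y m ^ 2 := Finset.sum_nonneg fun _ _ => sq_nonneg _
  rcases le_or_gt (1 - Q i k ^ 2) 0 with h3 | h3
  · nlinarith
  · nlinarith

/-! ### Lower bounds for back substitution -/

/-- Coefficients differ from 1, by at most 2, only for l ≤ m - h, and there the |z l| sum to at most
2^(m-h). -/
theorem IsBackSubstitution.sub_le {N h : ℕ} {c : ℕ → ℕ → ℝ} {z : ℕ → ℝ}
    (hz : IsBackSubstitution N c z) (hh : 1 ≤ h)
    (hc : ∀ m l, m ≤ N → l < m → m < l + h → c m l = 1) {m : ℕ} (h1 : 1 ≤ m) (hm : m ≤ N) :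
    ∑ l ∈ Finset.range m, z l - 2 * (2 ^ m / 2 ^ h) ≤ z m := by
  have he : ∑ l ∈ Finset.range m, z l - z m = ∑ l ∈ Finset.range m, (1 - c m l) * z l := by
    rw [hz.eq_sum m h1 hm, ← Finset.sum_sub_distrib]
    exact Finset.sum_congr rfl fun l _ => by ring
  suffices ∑ l ∈ Finset.range m, (1 - c m l) * z l ≤ 2 * (2 ^ m / 2 ^ h) by linarith
  rcases lt_or_ge m h with hmh | hmh
  · rw [Finset.sum_eq_zero]
    · positivity
    · intro l hl
      rw [hc m l hm (Finset.mem_range.1 hl) (by omega), sub_self, zero_mul]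
  · rw [← Finset.sum_subset (s₁ := Finset.range (m - h + 1))
      (Finset.range_subset_range.2 (by omega))]
    · calc _ ≤ ∑ l ∈ Finset.range (m - h + 1), 2 * |z l| := by
            refine Finset.sum_le_sum fun l _ => (le_abs_self _).trans ?_
            rw [abs_mul]
            refine mul_le_mul_of_nonneg_right ?_ (abs_nonneg _)
            have := _root_.abs_le.1 (hz.coeff_le m l)
            rw [_root_.abs_le]
            constructor <;> linarith
        _ = 2 * ∑ l ∈ Finset.range (m - h + 1), |z l| := by rw [Finset.mul_sum]
        _ ≤ 2 * 2 ^ (m - h) :=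
            mul_le_mul_of_nonneg_left (hz.sum_abs_le _ (by omega)) (by norm_num)
        _ = 2 * (2 ^ m / 2 ^ h) := by rw [pow_sub₀ _ (by norm_num) hmh, div_eq_mul_inv]
    · intro l hl hl2
      rw [Finset.mem_range] at hl hl2
      rw [hc m l hm hl (by omega), sub_self, zero_mul]

theorem IsBackSubstitution.le_sum {N h : ℕ} {c : ℕ → ℕ → ℝ} {z : ℕ → ℝ}
    (hz : IsBackSubstitution N c z) (hh : 1 ≤ h)
    (hc : ∀ m l, m ≤ N → l < m → m < l + h → c m l = 1) (m : ℕ) (hm : m ≤ N) :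
    2 ^ m * (1 - 2 * m / 2 ^ h) ≤ ∑ l ∈ Finset.range (m + 1), z l := by
  induction m with
  | zero => simp [hz.zero]
  | succ m ih =>
    have h1 := hz.sub_le hh hc (m := m + 1) (by omega) hm
    have h2 := ih (by omega)
    rw [Finset.sum_range_succ]
    have h3 : (2 : ℝ) ^ (m + 1) * (1 - 2 * (m + 1 : ℕ) / 2 ^ h) =
        2 * (2 ^ m * (1 - 2 * m / 2 ^ h)) - 2 * (2 ^ (m + 1) / 2 ^ h) := by
      push_cast
      ring
    rw [h3]
    linarith

theorem IsBackSubstitution.le_apply {N h : ℕ} {c : ℕ → ℕ → ℝ} {z : ℕ → ℝ}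
    (hz : IsBackSubstitution N c z) (hh : 1 ≤ h)
    (hc : ∀ m l, m ≤ N → l < m → m < l + h → c m l = 1) {m : ℕ} (hm : m + 1 ≤ N) :
    2 ^ m * (1 - (2 * N + 2) / 2 ^ h) ≤ z (m + 1) := by
  have h1 := hz.sub_le hh hc (m := m + 1) (by omega) hm
  have h2 := hz.le_sum hh hc m (by omega)
  have h3 : (2 : ℝ) ^ m * (1 - (2 * m + 4) / 2 ^ h) =
      2 ^ m * (1 - 2 * m / 2 ^ h) - 2 * (2 ^ (m + 1) / 2 ^ h) := by ring
  refine le_trans (mul_le_mul_of_nonneg_left ?_ (by positivity)) (h3.le.trans (by linarith))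
  have : (m : ℝ) + 1 ≤ N := by exact_mod_cast hm
  have : (2 * (m : ℝ) + 4) / 2 ^ h ≤ (2 * N + 2) / 2 ^ h :=
    div_le_div_of_nonneg_right (by linarith) (by positivity)
  linarith

theorem le_sum_sq {N : ℕ} {z : ℕ → ℝ} {a : ℝ} (ha0 : 0 ≤ a) (ha : a ≤ 1) (h0 : z 0 = 1)
    (h : ∀ m, m + 1 ≤ N → 2 ^ m * a ≤ z (m + 1)) :
    a ^ 2 * 4 ^ N / 3 ≤ ∑ m ∈ Finset.range (N + 1), z m ^ 2 := by
  induction N with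
  | zero =>
    simp only [zero_add, Finset.sum_range_one, h0]
    nlinarith
  | succ N ih =>
    rw [Finset.sum_range_succ]
    have h1 := ih fun m hm => h m (by omega)
    have h2 := pow_le_pow_left₀ (by positivity) (h N le_rfl) 2
    have h4 : (2 ^ N * a) ^ 2 = a ^ 2 * 4 ^ N := by
      rw [mul_pow, ← pow_mul, mul_comm N, pow_mul]; norm_num; ring
    rw [h4] at h2
    rw [pow_succ (4 : ℝ)]
    linarith

/-! ### The extremal lower factor -/

/-- Among the row indices `0, …, n - 1`, those in the lower half are paired with the indices
`1, 2, …` in the upper half; the indices in the upper half are their own pairs. -/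
def pairIndex (n i : ℕ) : ℕ := if i < (n + 1) / 2 then i else max 1 (i - n / 2)

/-- The matrix with ones on the diagonal, zeros above it and, below it, entries `-1`, except for
one entry `1` in each row of the lower half, in the column given by `pairIndex`. -/
def pairedLower (n : ℕ) : Matrix (Fin n) (Fin n) ℝ :=
  Matrix.of fun i j =>
    if j = i ∨ (j : ℕ) = pairIndex n i then 1 else if j < i then -1 else 0

theorem pairIndex_le {n i : ℕ} (hi : i < n) : pairIndex n i ≤ i := by
  unfold pairIndex; split_ifs <;> omega

theorem pairIndex_lt {n i : ℕ} (hn : 4 ≤ n) (hi : i < n) : pairIndex n i < (n + 1) / 2 := by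
  unfold pairIndex; split_ifs <;> omega

theorem pairIndex_of_lt {n i : ℕ} (hi : i < (n + 1) / 2) : pairIndex n i = i := if_pos hi

theorem one_le_pairIndex {n i : ℕ} (hi : 1 ≤ i) : 1 ≤ pairIndex n i := by
  unfold pairIndex; split_ifs <;> omega

theorem pairedLower_pair (i j : Fin n) (h : (j : ℕ) = pairIndex n i) : pairedLower n i j = 1 := by
  simp [pairedLower, h]

theorem pairedLower_of_lt {i j : Fin n} (h : j < i) (h2 : (j : ℕ) ≠ pairIndex n i) :
    pairedLower n i j = -1 := by
  simp [pairedLower, h, h2, h.ne]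

theorem pairedLower_isPivotedLower (n : ℕ) : IsPivotedLower (pairedLower n) := by
  refine ⟨fun i => by simp [pairedLower], fun i j h => ?_, fun i j => ?_⟩
  · have h2 : (j : ℕ) ≠ pairIndex n i := by
      have := pairIndex_le i.2
      rw [Fin.lt_def] at h
      omega
    simp [pairedLower, h2, h.ne', h.not_gt]
  · simp only [pairedLower, Matrix.of_apply]
    split_ifs <;> simp

theorem sum_indicator_le (a : ℕ) : ∑ m : Fin n, (if (m : ℕ) = a then (1 : ℝ) else 0) ≤ 1 := by
  by_cases h : a < n
  · rw [Finset.sum_eq_single ⟨a, h⟩]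
    · simp
    · intro m _ hm
      rw [if_neg fun h' => hm (Fin.ext h')]
    · simp
  · rw [Finset.sum_eq_zero]
    · exact zero_le_one
    · intro m _
      rw [if_neg (by omega)]

/-- Columns r and s agree except in at most three rows with difference up to 2 and two rows with
difference up to 1: 3 · 4 + 2 = 14. For even n, column 1 can receive two paired rows, n/2 and n/2 +
1; taking s = 0 when r = 2 avoids one exceptional row too many. -/
theorem sum_sq_col_sub_le {r s : Fin n} (h1 : 1 ≤ (r : ℕ)) (hs : (s : ℕ) = if (r : ℕ) = 2 then 0 else (r : ℕ) - 1) :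
    ∑ m, (pairedLower n m r - pairedLower n m s) ^ 2 ≤ 14 := by
  have hL := pairedLower_isPivotedLower n
  have key : ∀ m : Fin n, (pairedLower n m r - pairedLower n m s) ^ 2 ≤
      4 * (if (m : ℕ) = r then 1 else 0) + 4 * (if (m : ℕ) = r + n / 2 then 1 else 0) +
        4 * (if (m : ℕ) = r - 1 + n / 2 then 1 else 0) + (if (m : ℕ) = s then 1 else 0) +
        (if (m : ℕ) = r - 1 then 1 else 0) := by
    intro m
    have a := abs_le.1 (hL.abs_le m r)
    have b := abs_le.1 (hL.abs_le m s)
    have hsq : (pairedLower n m r - pairedLower n m s) ^ 2 ≤ 4 := by nlinarith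
    have i0 : ∀ p : Prop, ∀ [Decidable p], (0 : ℝ) ≤ if p then 1 else 0 := fun p _ => by
      split_ifs <;> norm_num
    have i1 := i0 ((m : ℕ) = r)
    have i2 := i0 ((m : ℕ) = r + n / 2)
    have i3 := i0 ((m : ℕ) = r - 1 + n / 2)
    have i4 := i0 ((m : ℕ) = s)
    have i5 := i0 ((m : ℕ) = r - 1)
    rcases lt_trichotomy (m : ℕ) r with hm | hm | hm
    · rw [hL.upper m r hm, zero_sub, neg_sq]
      by_cases hm1 : (m : ℕ) = r - 1
      · rw [if_pos hm1]
        nlinarith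
      · by_cases hm2 : (m : ℕ) = s
        · rw [if_pos hm2]
          nlinarith
        · have hlt : (m : ℕ) < s := by split_ifs at hs <;> omega
          rw [hL.upper m s hlt]
          linarith
    · rw [if_pos hm]
      linarith
    · by_cases hm2 : (m : ℕ) = r + n / 2
      · rw [if_pos hm2]
        linarith
      · by_cases hm3 : (m : ℕ) = r - 1 + n / 2
        · rw [if_pos hm3]
          linarith
        · have hp : (r : ℕ) ≠ pairIndex n m ∧ (s : ℕ) ≠ pairIndex n m := by
            unfold pairIndex
            split_ifs at hs ⊢ <;> omega
          have hsm : s < m := by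
            rw [Fin.lt_def]
            split_ifs at hs <;> omega
          rw [pairedLower_of_lt hm hp.1, pairedLower_of_lt hsm hp.2]
          linarith
  refine (Finset.sum_le_sum fun m _ => key m).trans ?_
  simp only [Finset.sum_add_distrib, ← Finset.mul_sum]
  have j1 := sum_indicator_le (n := n) (r : ℕ)
  have j2 := sum_indicator_le (n := n) ((r : ℕ) + n / 2)
  have j3 := sum_indicator_le (n := n) ((r : ℕ) - 1 + n / 2)
  have j4 := sum_indicator_le (n := n) (s : ℕ)
  have j5 := sum_indicator_le (n := n) ((r : ℕ) - 1)
  linarith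

/-- Outside its first row and its last column, an orthogonal matrix with lower factor
`pairedLower n` has entries at most `√3 / 2` in absolute value. -/
theorem sq_pairedLower_mul_le (hn : 4 ≤ n) {U : Matrix (Fin n) (Fin n) ℝ} (hU : IsUpper U)
    (hQ : pairedLower n * U ∈ Matrix.orthogonalGroup (Fin n) ℝ)
    (hR : ∀ r k, r < k → ∑ i, pairedLower n i r * (pairedLower n * U) i k = 0)
    {i : Fin n} (hi : 1 ≤ (i : ℕ)) (k : Fin n) : (pairedLower n * U) i k ^ 2 ≤ 3 / 4 := by
  have hle := pairIndex_le i.2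
  have h1 := one_le_pairIndex (n := n) hi
  have h2 := pairIndex_lt hn i.2
  obtain ⟨r, hr⟩ : ∃ r : Fin n, (r : ℕ) = pairIndex n i := ⟨⟨pairIndex n i, by omega⟩, rfl⟩
  rw [← hr] at hle h1 h2
  -- For k > r, column k is orthogonal to the difference of the columns r and s of L, which is 2 in
  -- row i and has squared length at most 14 ≤ 4 · 2².
  rcases lt_or_ge r k with hrk | hrk
  · obtain ⟨s, hs⟩ : ∃ s : Fin n, (s : ℕ) = if (r : ℕ) = 2 then 0 else (r : ℕ) - 1 :=
      ⟨⟨if (r : ℕ) = 2 then 0 else (r : ℕ) - 1, by split_ifs <;> omega⟩, rfl⟩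
    have hsr : s < r := by
      rw [Fin.lt_def]
      split_ifs at hs <;> omega
    have hy : pairedLower n i r - pairedLower n i s = 2 := by
      rw [pairedLower_pair i r hr, pairedLower_of_lt (hsr.trans_le hle)]
      · norm_num
      · rw [← hr]; exact (Fin.lt_def.1 hsr).ne
    refine sq_entry_le hQ (y := fun m => pairedLower n m r - pairedLower n m s) ?_ ?_ ?_
    · simp only [sub_mul, Finset.sum_sub_distrib]
      rw [hR r k hrk, hR s k (hsr.trans hrk), sub_zero]
    · rw [hy]; norm_num
    · rw [hy]
      exact (sum_sq_col_sub_le h1 hs).trans (by norm_num)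
  -- For k ≤ r, row i and a partner p with the same paired column agree in the columns of L up to r,
  -- so Q i k = Q p k, and e_i - e_p serves as test vector.
  · obtain ⟨p, hpi, hp⟩ : ∃ p : Fin n, p ≠ i ∧ pairIndex n p = r := by
      by_cases hir : i = r
      · refine ⟨⟨r + n / 2, by omega⟩, fun h => ?_, ?_⟩
        · rw [← h, Fin.ext_iff] at hir
          simp at hir
          omega
        · simp only [pairIndex]
          split_ifs <;> omega
      · exact ⟨r, Ne.symm hir, pairIndex_of_lt h2⟩
    have hrow : ∀ j ≤ r, pairedLower n i j = pairedLower n p j := by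
      intro j hj
      have hpr : r ≤ p := by
        rw [Fin.le_def, ← hp]; exact pairIndex_le p.2
      rcases hj.eq_or_lt with rfl | hj
      · rw [pairedLower_pair i j hr, pairedLower_pair p j hp.symm]
      · rw [pairedLower_of_lt (hj.trans_le hle) (by rw [← hr]; exact (Fin.lt_def.1 hj).ne),
          pairedLower_of_lt (hj.trans_le hpr) (by rw [hp]; exact (Fin.lt_def.1 hj).ne)]
    have hsum : ∀ g : Fin n → ℝ, ∑ m, ((if m = i then 1 else 0) - (if m = p then 1 else 0)) * g m =
        g i - g p := fun g => by
      simp [sub_mul, Finset.sum_sub_distrib]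
    refine sq_entry_le hQ
      (y := fun m => (if m = i then 1 else 0) - (if m = p then 1 else 0)) ?_ ?_ ?_
    · rw [hsum, Matrix.mul_apply, Matrix.mul_apply, ← Finset.sum_sub_distrib]
      refine Finset.sum_eq_zero fun l _ => ?_
      rcases lt_or_ge k l with hl | hl
      · rw [hU l k hl]; ring
      · rw [hrow l (hl.trans hrk), sub_self]
    · simp [hpi.symm]
    · simp only [sq]
      rw [hsum]
      simp [hpi, hpi.symm]
      norm_num

/-! ### Lower bound for the growth factor -/

theorem le_luGrowth {N : ℕ} {L U : Matrix (Fin (N + 1)) (Fin (N + 1)) ℝ} (hL : IsPivotedLower L)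
    (hQ : L * U ∈ Matrix.orthogonalGroup (Fin (N + 1)) ℝ) {g : ℝ}
    (h : ∀ i k, g * |(L * U) i k| ≤ |U (Fin.last N) (Fin.last N)|) : g ≤ luGrowth L U := by
  rw [luGrowth, le_div_iff₀ (maxNorm_pos hQ)]
  have h1 : |U (Fin.last N) (Fin.last N)| ≤ ⨆ k : Fin (N + 1), maxNorm (partialProduct k L U) := by
    refine le_trans ?_ (le_ciSup (Set.finite_range _).bddAbove (Fin.last N))
    have := abs_le_maxNorm (partialProduct N L U) (Fin.last N) (Fin.last N)
    rwa [partialProduct_row hL U N _ _ (by simp)] at this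
  obtain ⟨p, hp⟩ := exists_eq_ciSup_of_finite
    (f := fun p : Fin (N + 1) × Fin (N + 1) => |(L * U) p.1 p.2|)
  rw [maxNorm, ← hp]
  exact (h p.1 p.2).trans h1

theorem le_maxOrthogonalGrowth [NeZero n] {A : Matrix (Fin n) (Fin n) ℝ}
    (hA : A ∈ Matrix.orthogonalGroup (Fin n) ℝ) : growthFactor A ≤ maxOrthogonalGrowth n := by
  obtain ⟨g, hg⟩ := exists_isGreatest n
  rw [maxOrthogonalGrowth, hg.csSup_eq]
  exact hg.2 ⟨A, hA, rfl⟩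

/-- Here `a` measures how far the 1s in `pairedLower` keep the back substitution below 2^m; the
condition 3/4 ≤ a serves only the first row of Q. -/
theorem two_thirds_le_maxOrthogonalGrowth {N : ℕ} (hN : 3 ≤ N) {a : ℝ}
    (ha : a = 1 - (2 * N + 2) / 2 ^ ((N + 1) / 2 - 1)) (ha' : 3 / 4 ≤ a) :
    a ^ 2 * (2 / 3 * 2 ^ N) ≤ maxOrthogonalGrowth (N + 1) := by
  have hL := pairedLower_isPivotedLower (N + 1)
  obtain ⟨U, hU, hQ, hR⟩ := hL.exists_orthogonal
  have ha1 : a ≤ 1 := by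
    rw [ha]
    have : (0 : ℝ) ≤ (2 * N + 2) / 2 ^ ((N + 1) / 2 - 1) := by positivity
    linarith
  refine le_trans ?_ (le_maxOrthogonalGrowth hQ)
  rw [growthFactor_mul hL hU (hU.diag_ne_zero hQ)]
  set L := pairedLower (N + 1) with hLdef
  set u := U (Fin.last N) (Fin.last N) with hu
  have hx := sum_lastCol_mul hU hQ
  have hz := isBackSubstitution_of_mul_eq hL hx
  have hsq := sum_lastCol_sq hQ u (Fin.last N)
  have hsq' : ∑ m ∈ Finset.range (N + 1), (u * (L * U) ⟨N - m, by omega⟩ (Fin.last N)) ^ 2 =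
      u ^ 2 := by
    rw [← hsq, ← Equiv.sum_comp Fin.revPerm, ← Fin.sum_univ_eq_sum_range
      (fun l : ℕ => (u * (L * U) ⟨N - l, by omega⟩ (Fin.last N)) ^ 2)]
    refine Finset.sum_congr rfl fun i _ => ?_
    have hi : Fin.revPerm i = ⟨N - i, by omega⟩ := by ext; simp [Fin.val_rev]
    rw [hi]
  have hlow : ∀ m, m + 1 ≤ N → 2 ^ m * a ≤ u * (L * U) ⟨N - (m + 1), by omega⟩ (Fin.last N) := by
    intro m hm
    rw [ha]
    -- The entries 1 below the diagonal lie at least (N + 1) / 2 - 1 rows below it, with equality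
    -- possible for even order because of the `max` in `pairIndex`.
    refine hz.le_apply (h := (N + 1) / 2 - 1) (by omega) ?_ hm
    intro m l hm hl hml
    rw [hLdef, pairedLower_of_lt, neg_neg]
    · rw [Fin.lt_def]; simp only; omega
    · simp only [pairIndex]
      split_ifs <;> omega
  have hu2 : a ^ 2 * 4 ^ N / 3 ≤ u ^ 2 := by
    rw [← hsq']
    exact le_sum_sq (z := fun m => u * (L * U) ⟨N - m, by omega⟩ (Fin.last N))
      (by linarith) ha1 hz.zero hlow
  have hupper : u ^ 2 ≤ (4 ^ N + 2) / 3 := by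
    rw [← hsq']
    have h := sum_sq_le (z := fun m => |u * (L * U) ⟨N - m, by omega⟩ (Fin.last N)|)
      (fun _ => abs_nonneg _) (by rw [hz.zero, abs_one]) N (by omega) fun m hm => hz.abs_le m hm
    simpa only [sq_abs] using h
  have h4 : (4 : ℝ) ^ N = 2 ^ N * 2 ^ N := by rw [← mul_pow]; norm_num
  have hP : (8 : ℝ) ≤ 2 ^ N := by
    calc (8 : ℝ) = 2 ^ 3 := by norm_num
      _ ≤ 2 ^ N := pow_le_pow_right₀ (by norm_num) hN
  have hNsucc : (2 : ℝ) ^ N = 2 * 2 ^ (N - 1) := by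
    rw [← pow_succ']; congr 1; omega
  have hu0 : 0 < |u| := by
    rw [abs_pos]
    exact hU.diag_ne_zero hQ _
  refine le_luGrowth hL hQ fun i k => ?_
  by_cases hk : k = Fin.last N
  · subst hk
    have hxi : |u * (L * U) i (Fin.last N)| ≤ 2 ^ (N - 1) := by
      rcases Nat.lt_or_ge i N with hi | hi
      · have h := hz.abs_le (N - i - 1) (by omega)
        have hii : (⟨N - (N - i - 1 + 1), by omega⟩ : Fin (N + 1)) = i := by
          ext; simp only; omega
        rw [hii] at h
        exact h.trans (pow_le_pow_right₀ (by norm_num) (by omega))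
      · have hii : i = ⟨N - 0, by omega⟩ := by ext; simp only; omega
        have h : u * (L * U) ⟨N - 0, by omega⟩ (Fin.last N) = 1 := hz.zero
        rw [hii, h, abs_one]
        exact one_le_pow₀ (by norm_num)
    rw [abs_mul] at hxi
    refine le_of_mul_le_mul_left ?_ hu0
    rw [← sq, sq_abs]
    calc |u| * (a ^ 2 * (2 / 3 * 2 ^ N) * |(L * U) i (Fin.last N)|)
        = a ^ 2 * (2 / 3 * 2 ^ N) * (|u| * |(L * U) i (Fin.last N)|) := by ring
      _ ≤ a ^ 2 * (2 / 3 * 2 ^ N) * 2 ^ (N - 1) := by gcongr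
      _ = a ^ 2 * 4 ^ N / 3 := by rw [h4, hNsucc]; ring
      _ ≤ u ^ 2 := hu2
  · have hentry : (L * U) i k ^ 2 ≤ 3 / 4 := by
      by_cases hi : 1 ≤ (i : ℕ)
      · exact sq_pairedLower_mul_le (by omega) hU hQ hR hi k
      -- In row 0 the scaled last column is itself the test vector: it is orthogonal to column k,
      -- and its first entry carries more than a quarter of its squared length.
      · have hi0 : i = ⟨N - (N - 1 + 1), by omega⟩ := by ext; simp only; omega
        have hx0 : 2 ^ (N - 1) * a ≤ u * (L * U) i (Fin.last N) := by
          rw [hi0]; exact hlow (N - 1) (by omega)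
        have hx1 : 2 ^ (N - 1) * (3 / 4) ≤ u * (L * U) i (Fin.last N) :=
          (mul_le_mul_of_nonneg_left ha' (by positivity)).trans hx0
        have hx2 := pow_le_pow_left₀ (by positivity) hx1 2
        refine sq_entry_le hQ (y := fun m => u * (L * U) m (Fin.last N)) ?_ ?_ ?_
        · rw [Matrix.mem_orthogonalGroup_iff'] at hQ
          have h := congrFun (congrFun hQ (Fin.last N)) k
          rw [Matrix.mul_apply, Matrix.one_apply_ne (Ne.symm hk)] at h
          have h' : ∑ m, (L * U) m (Fin.last N) * (L * U) m k = 0 := h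
          rw [← mul_zero u, ← h', Finset.mul_sum]
          exact Finset.sum_congr rfl fun m _ => mul_assoc _ _ _
        · exact lt_of_lt_of_le (by positivity) hx2
        · rw [hsq]
          rw [h4, hNsucc] at hupper
          rw [hNsucc] at hP
          nlinarith
    refine abs_le_of_sq_le_sq' ?_ (abs_nonneg u) |>.2
    rw [sq_abs, mul_pow, sq_abs]
    calc (a ^ 2 * (2 / 3 * 2 ^ N)) ^ 2 * (L * U) i k ^ 2
        ≤ (a ^ 2 * (2 / 3 * 2 ^ N)) ^ 2 * (3 / 4) := by gcongr
      _ = a ^ 2 * (a ^ 2 * 4 ^ N / 3) := by rw [h4]; ring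
      _ ≤ 1 * (a ^ 2 * 4 ^ N / 3) := by
          gcongr
          exact pow_le_one₀ (by linarith) ha1
      _ ≤ u ^ 2 := by rw [one_mul]; exact hu2

/-! ### The largest growth factor -/

theorem isGreatest_maxOrthogonalGrowth (n : ℕ) [NeZero n] :
    IsGreatest (orthogonalGrowthFactors n) (maxOrthogonalGrowth n) := by
  obtain ⟨g, hg⟩ := exists_isGreatest n
  rw [maxOrthogonalGrowth, hg.csSup_eq]
  exact hg

theorem maxOrthogonalGrowth_le {N : ℕ} (hN : 1 ≤ N) :
    maxOrthogonalGrowth (N + 1) ≤ (4 ^ N + 2) / (3 * 2 ^ (N - 1)) := by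
  obtain ⟨A, hA, h⟩ := (isGreatest_maxOrthogonalGrowth (N + 1)).1
  rw [← h]
  exact growthFactor_le hN hA

theorem maxOrthogonalGrowth_one : maxOrthogonalGrowth 1 = 1 := by
  obtain ⟨A, hA, h⟩ := (isGreatest_maxOrthogonalGrowth 1).1
  have hpos := maxNorm_pos (lower_mul_stage_mem A hA)
  rw [← h, growthFactor_eq_luGrowth, luGrowth, ciSup_unique]
  simp only [Fin.default_eq_zero, Fin.val_zero, partialProduct_zero]
  exact div_self hpos.ne'

theorem maxOrthogonalGrowth_two : maxOrthogonalGrowth 2 = 2 := by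
  refine le_antisymm ?_ ?_
  · have h := maxOrthogonalGrowth_le (N := 1) le_rfl
    norm_num at h
    exact h
  · have hs : √2 / 2 * (√2 / 2) = 1 / 2 := by
      have := Real.mul_self_sqrt (show (0 : ℝ) ≤ 2 by norm_num)
      linarith
    have hs0 : 0 < √2 / 2 := by positivity
    generalize √2 / 2 = s at hs hs0
    have hL : IsPivotedLower !![(1 : ℝ), 0; -1, 1] := by
      refine ⟨fun i => ?_, fun i j hij => ?_, fun i j => ?_⟩
      · fin_cases i <;> simp
      · fin_cases i <;> fin_cases j <;> simp at hij ⊢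
      · fin_cases i <;> fin_cases j <;> simp
    have hU : IsUpper !![s, s; 0, 2 * s] := by
      intro i j hij
      fin_cases i <;> fin_cases j <;> simp at hij ⊢
    have hLU : !![(1 : ℝ), 0; -1, 1] * !![s, s; 0, 2 * s] = !![s, s; -s, s] := by
      ext i j
      fin_cases i <;> fin_cases j <;> simp [Matrix.mul_apply, Fin.sum_univ_two]
      ring
    have hQ : !![(1 : ℝ), 0; -1, 1] * !![s, s; 0, 2 * s] ∈ Matrix.orthogonalGroup (Fin 2) ℝ := by
      rw [hLU, Matrix.mem_orthogonalGroup_iff]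
      ext i j
      fin_cases i <;> fin_cases j <;> simp [Matrix.mul_apply, Fin.sum_univ_two] <;> linarith
    refine le_trans ?_ (le_maxOrthogonalGrowth hQ)
    rw [growthFactor_mul hL hU (hU.diag_ne_zero hQ)]
    refine le_luGrowth hL hQ fun i k => ?_
    rw [hLU]
    fin_cases i <;> fin_cases k <;> simp [Fin.last]

theorem maxOrthogonalGrowth_lt {N : ℕ} (hN : 2 ≤ N) : maxOrthogonalGrowth (N + 1) < 2 ^ N := by
  refine (maxOrthogonalGrowth_le (by omega)).trans_lt ?_
  obtain ⟨N, rfl⟩ : ∃ K, N = K + 1 := ⟨N - 1, by omega⟩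
  rw [div_lt_iff₀ (by positivity)]
  have h4 : (4 : ℝ) ^ N = 2 ^ N * 2 ^ N := by rw [← mul_pow]; norm_num
  have hP : (2 : ℝ) ≤ 2 ^ N := by
    calc (2 : ℝ) = 2 ^ 1 := by norm_num
      _ ≤ 2 ^ N := pow_le_pow_right₀ (by norm_num) (by omega)
  simp only [pow_succ, h4, Nat.add_sub_cancel]
  nlinarith

/-! ### Asymptotics -/

theorem tendsto_window_loss :
    Tendsto (fun N : ℕ => (2 * (N : ℝ) + 2) / 2 ^ ((N + 1) / 2 - 1)) atTop (𝓝 0) := by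
  have h1 : Tendsto (fun k : ℕ => (k : ℝ) / 2 ^ k) atTop (𝓝 0) := by
    have h := tendsto_pow_const_div_const_pow_of_one_lt 1 (r := (2 : ℝ)) (by norm_num)
    simpa using h
  have h2 : Tendsto (fun k : ℕ => (8 : ℝ) / 2 ^ k) atTop (𝓝 0) :=
    tendsto_const_nhds.div_atTop (tendsto_pow_atTop_atTop_of_one_lt (by norm_num))
  have h3 : Tendsto (fun k : ℕ => 4 * ((k : ℝ) / 2 ^ k) + 8 / 2 ^ k) atTop (𝓝 0) := by
    simpa using (h1.const_mul 4).add h2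
  have h4 : Tendsto (fun N : ℕ => (N + 1) / 2 - 1) atTop atTop :=
    tendsto_atTop_atTop.2 fun b => ⟨2 * b + 2, fun N hN => by omega⟩
  refine squeeze_zero (fun N => by positivity) (fun N => ?_) (h3.comp h4)
  simp only [Function.comp_apply]
  rw [← mul_div_assoc, ← add_div]
  refine div_le_div_of_nonneg_right ?_ (by positivity)
  have : N ≤ 2 * ((N + 1) / 2 - 1) + 2 := by omega
  have : (N : ℝ) ≤ 2 * ((N + 1) / 2 - 1 : ℕ) + 2 := by exact_mod_cast this
  linarith

/-- The largest growth factor of orthogonal matrices of order `N + 1` is asymptotic to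
`2 / 3 * 2 ^ N`. -/
theorem tendsto_maxOrthogonalGrowth_div :
    Tendsto (fun N : ℕ => maxOrthogonalGrowth (N + 1) / (2 / 3 * 2 ^ N)) atTop (𝓝 1) := by
  have hlow : Tendsto (fun N : ℕ => (1 - (2 * (N : ℝ) + 2) / 2 ^ ((N + 1) / 2 - 1)) ^ 2)
      atTop (𝓝 1) := by
    simpa using (tendsto_window_loss.const_sub 1).pow 2
  have hupp : Tendsto (fun N : ℕ => 1 + 2 / (4 : ℝ) ^ N) atTop (𝓝 1) := by
    have h : Tendsto (fun N : ℕ => 2 / (4 : ℝ) ^ N) atTop (𝓝 0) :=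
      tendsto_const_nhds.div_atTop (tendsto_pow_atTop_atTop_of_one_lt (by norm_num))
    simpa using h.const_add 1
  refine tendsto_of_tendsto_of_tendsto_of_le_of_le' hlow hupp ?_ ?_
  · have hev := tendsto_window_loss.eventually (gt_mem_nhds (show (0 : ℝ) < 1 / 4 by norm_num))
    filter_upwards [hev, eventually_ge_atTop 3] with N h1 hN
    rw [le_div_iff₀ (by positivity)]
    exact two_thirds_le_maxOrthogonalGrowth hN rfl (by linarith)
  · filter_upwards [eventually_ge_atTop 1] with N hN
    rw [div_le_iff₀ (by positivity)]
    refine (maxOrthogonalGrowth_le hN).trans (le_of_eq ?_)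
    obtain ⟨N, rfl⟩ : ∃ K, N = K + 1 := ⟨N - 1, by omega⟩
    have h4 : (4 : ℝ) ^ N = 2 ^ N * 2 ^ N := by rw [← mul_pow]; norm_num
    simp only [pow_succ, h4, Nat.add_sub_cancel]
    field_simp
    ring

end GEPP

end

theorem theorem3p4 :
    -- the supremum that defines the largest growth factor is a maximum
    (∀ n : ℕ, 1 ≤ n →
      IsGreatest (GEPP.orthogonalGrowthFactors n) (GEPP.maxOrthogonalGrowth n)) ∧
    (∀ n : ℕ, n = 1 ∨ n = 2 → GEPP.maxOrthogonalGrowth n = 2 ^ (n - 1)) ∧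
    (∀ n : ℕ, 3 ≤ n → GEPP.maxOrthogonalGrowth n < 2 ^ (n - 1)) ∧
    (∃ c : ℝ, 1 / √3 ≤ c ∧ c < 1 ∧
      ∃ ε : ℕ → ℝ, ε =o[atTop] (fun _ => (1 : ℝ)) ∧
        ∀ n : ℕ, 3 ≤ n → GEPP.maxOrthogonalGrowth n = c * 2 ^ (n - 1) * (1 + ε n)) := by
  -- With c = 2/3, the bound 1/√3 ≤ c amounts to √3 ≥ 3/2.
  refine ⟨fun n hn => ?_, ?_, fun n hn => ?_, 2 / 3, ?_, by norm_num,
    fun n => GEPP.maxOrthogonalGrowth n / (2 / 3 * 2 ^ (n - 1)) - 1, ?_, fun n _ => ?_⟩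
  · have : NeZero n := ⟨by omega⟩
    exact GEPP.isGreatest_maxOrthogonalGrowth n
  · rintro n (rfl | rfl)
    · simp [GEPP.maxOrthogonalGrowth_one]
    · simp [GEPP.maxOrthogonalGrowth_two]
  · obtain ⟨N, rfl⟩ : ∃ K, n = K + 1 := ⟨n - 1, by omega⟩
    exact GEPP.maxOrthogonalGrowth_lt (by omega)
  · rw [div_le_iff₀ (by positivity)]
    have h : 3 / 2 ≤ √3 := Real.le_sqrt_of_sq_le (by norm_num)
    linarith
  · rw [isLittleO_one_iff, ← tendsto_add_atTop_iff_nat 1]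
    simpa using GEPP.tendsto_maxOrthogonalGrowth_div.sub_const 1
  · field_simp
    ring
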